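/- For a positive integer $n$ put $\zeta_n=\exp(2\pi i/n)$; $\sqrt{\cdot}$ is the principal branch. For $\operatorname{Re}\alpha>0$ define the Mordell integrals $$J\left(\tfrac ac;\alpha\right)=\int_0^\infty e^{-\frac32\alpha x^2}\,\frac{\cosh\left(\left(\frac{3a}{c}-2\right)\alpha x\right)+\cosh\left(\left(\frac{3a}{c}-1\right)\alpha x\right)}{\cosh(3\alpha x/2)}\,dx,$$ $$J(a,b,c;\alpha)=\int_{-\infty}^\infty e^{-\frac32\alpha x^2+3\alpha x\frac ac}\,\frac{\zeta_c^{b}e^{-\alpha x}+\zeta_c^{2b}e^{-2\alpha x}}{\cosh\left(\frac{3\alpha x}{2}-3\pi i\frac bc\right)}\,dx.$$ For $\operatorname{Im}z>0$, integers $k$ and $N\ge1$ let $\tilde\theta(k,N;z)=\sum_{m\in\mathbb Z}(Nm+k)\exp\left(\frac{\pi i z}{N}(Nm+k)^2\right)$, and define the theta functions $$\Theta\left(\tfrac ac;z\right)=\sum_{n\in\mathbb Z}(-1)^n(6n+1)\sin\left(\tfrac{\pi a(6n+1)}{c}\right)\exp\left(3\pi i z\left(n+\tfrac16\right)^2\right),$$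 $$\Theta_1(a,b,c;z)=\zeta_{c^2}^{3ab}\,\zeta_{2c}^{-a}\sum_{m=0}^{6c-1}(-1)^m\sin\left(\tfrac{\pi}{3}(2m+1)\right)\exp\left(\tfrac{-2\pi i m a}{c}\right)\tilde\theta(2mc-6b+c,12c^2;z),$$ $$\Theta_2(a,b,c;z)=\sum_{\ell=0}^{2c-1}(-1)^\ell\left(e^{-\frac{\pi i b}{c}(6\ell+1)}\,\tilde\theta(6c\ell+6a+c,12c^2;z)+e^{-\frac{\pi i b}{c}(6\ell-1)}\,\tilde\theta(6c\ell+6a-c,12c^2;z)\right).$$ Define the correction terms $\varepsilon_1,\varepsilon_2$ to be $0$ if $\frac16<\frac ac<\frac56$; for $\frac ac<\frac16$ let $$\varepsilon_1\left(\tfrac ac;z\right)=\tfrac{-2}{\sqrt{-iz}}\,e^{\frac{3\pi i}{z}\left(\frac ac-\frac16\right)^2},\qquad \varepsilon_1(a,b,c;z)=\tfrac{\zeta_{2c}^{b}}{\sqrt{-iz}}\,e^{\frac{3\pi i}{z}\left(\frac ac-\frac16\right)^2},$$ $$\varepsilon_2\left(\tfrac ac;z\right)=2\,e^{-3\pi i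 z\left(\frac ac-\frac16\right)^2},\qquad \varepsilon_2(a,b,c;z)=2\zeta_c^{-2b}\,e^{-3\pi i z\left(\frac ac-\frac16\right)^2},$$ and for $\frac ac>\frac56$ let $$\varepsilon_1\left(\tfrac ac;z\right)=\tfrac{-2}{\sqrt{-iz}}\,e^{\frac{3\pi i}{z}\left(\frac ac-\frac56\right)^2},\qquad \varepsilon_1(a,b,c;z)=\tfrac{\zeta_{2c}^{5b}}{\sqrt{-iz}}\,e^{\frac{3\pi i}{z}\left(\frac ac-\frac56\right)^2},$$ $$\varepsilon_2\left(\tfrac ac;z\right)=\varepsilon_2(a,b,c;z)=2\,e^{-3\pi i z\left(\frac ac-\frac56\right)^2}.$$ **Theorem.** Let $c$ be a positive odd integer and let $z$ satisfy $\operatorname{Im}z>0$. All integrals below converge absolutely; those from $0$ to $i\infty$ are taken along the positive imaginary axis. For all integers $a$ with $0<a<c$, $$\frac{2\sqrt3}{iz}\,J\left(\tfrac ac;\tfrac{2\pi i}{z}\right)=\frac{i}{\sqrt3}\int_0^{i\infty}\frac{\Theta\left(\frac ac;\tau\right)}{\sqrt{-i(\tau+z)}}\,d\tau+\varepsilon_1\left(\tfrac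 ac;z\right),$$ $$2\sqrt3\,\sqrt{-iz}\;J\left(\tfrac ac;-2\pi i z\right)=-\frac{i}{3c}\int_0^{i\infty}\frac{\Theta_1(0,-a,c;\tau)}{\sqrt{-i(\tau+z)}}\,d\tau+\varepsilon_2\left(\tfrac ac;z\right).$$ For all integers $a,b$ with $0\le a<c$ and $0<b<c$, $$\frac{\sqrt3}{-2iz}\,J\left(a,b,c;\tfrac{2\pi i}{z}\right)=\frac1{6c}\int_0^{i\infty}\frac{\Theta_1(a,b,c;\tau)}{\sqrt{-i(\tau+z)}}\,d\tau+\varepsilon_1(a,b,c;z),$$ $$\zeta_{2c}^{-5b}\sqrt3\,\sqrt{-iz}\;J(a,b,c;-2\pi i z)=-\zeta_{2c}^{-5b}\,\frac{i\sqrt3}{6c}\int_0^{i\infty}\frac{\Theta_2(a,b,c;\tau)}{\sqrt{-i(\tau+z)}}\,d\tau+\varepsilon_2(a,b,c;z).$$ -/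

import Mathlib

open Complex MeasureTheory

noncomputable section

/-- The root of unity `ζ_n = exp(2πi/n)`. -/
def zetaRoot (n : ℕ) : ℂ := exp (2 * Real.pi * I / n)

/-- The integrand of the Mordell integral `J(r; α)`, where `r = a/c`. -/
def mordellIntegrand (r : ℝ) (α : ℂ) (x : ℝ) : ℂ :=
  exp (-(3 / 2) * α * x ^ 2) *
    (cosh ((3 * r - 2) * α * x) + cosh ((3 * r - 1) * α * x)) / cosh (3 * α * x / 2)

/-- The Mordell integral `J(r; α)`, where `r = a/c`. -/
def mordellJ (r : ℝ) (α : ℂ) : ℂ :=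
  ∫ x in Set.Ioi (0 : ℝ), mordellIntegrand r α x

/-- The integrand of the Mordell integral `J(a, b, c; α)`. -/
def mordellIntegrandABC (a b : ℤ) (c : ℕ) (α : ℂ) (x : ℝ) : ℂ :=
  exp (-(3 / 2) * α * x ^ 2 + 3 * α * x * (a / c)) *
    (zetaRoot c ^ b * exp (-α * x) + zetaRoot c ^ (2 * b) * exp (-2 * α * x)) /
      cosh (3 * α * x / 2 - 3 * Real.pi * I * (b / c))

/-- The Mordell integral `J(a, b, c; α)`. -/
def mordellJABC (a b : ℤ) (c : ℕ) (α : ℂ) : ℂ :=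
  ∫ x : ℝ, mordellIntegrandABC a b c α x

/-- The theta function `θ̃(k, N; z) = ∑_{m ∈ ℤ} (N m + k) exp(π i z (N m + k)² / N)`. -/
def thetaTilde (k : ℤ) (N : ℕ) (z : ℂ) : ℂ :=
  ∑' m : ℤ, (N * m + k : ℂ) * exp (Real.pi * I * z / N * (N * m + k) ^ 2)

/-- The theta function `Θ₁(a, b, c; z)`. -/
def Theta1 (a b : ℤ) (c : ℕ) (z : ℂ) : ℂ :=
  zetaRoot (c ^ 2) ^ (3 * a * b) * zetaRoot (2 * c) ^ (-a) *
    ∑ m ∈ Finset.range (6 * c),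
      (-1) ^ m * sin (Real.pi / 3 * (2 * m + 1)) * exp (-2 * Real.pi * I * m * a / c) *
        thetaTilde (2 * m * c - 6 * b + c) (12 * c ^ 2) z

/-- The theta function `Θ₂(a, b, c; z)`. -/
def Theta2 (a b : ℤ) (c : ℕ) (z : ℂ) : ℂ :=
  ∑ l ∈ Finset.range (2 * c),
    ((-1) ^ l * exp (-Real.pi * I * b / c * (6 * l + 1)) *
        thetaTilde (6 * c * l + 6 * a + c) (12 * c ^ 2) z +
      (-1) ^ l * exp (-Real.pi * I * b / c * (6 * l - 1)) *
        thetaTilde (6 * c * l + 6 * a - c) (12 * c ^ 2) z)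

/-- The theta function `Θ(r; z)`, where `r = a/c`. -/
def ThetaRatio (r : ℝ) (z : ℂ) : ℂ :=
  ∑' n : ℤ, (-1) ^ n * (6 * n + 1) * sin (Real.pi * r * (6 * n + 1)) *
    exp (3 * Real.pi * I * z * (n + 1 / 6) ^ 2)

/-- The integrand `F(τ) / √(-i(τ + z))` at the point `τ = it` of the imaginary axis. -/
def periodIntegrand (F : ℂ → ℂ) (z : ℂ) (t : ℝ) : ℂ :=
  F (I * t) / Complex.sqrt (-I * (I * t + z))

/-- The period integral `∫_0^{i∞} F(τ) / √(-i(τ + z)) dτ` along the positive imaginary axis. -/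
def periodIntegral (F : ℂ → ℂ) (z : ℂ) : ℂ :=
  I * ∫ t in Set.Ioi (0 : ℝ), periodIntegrand F z t

/-- The correction term `ε₁(r; z)` for `0 < r < 1`, `r ≠ 1/6, 5/6`, where `r = a/c`. -/
def eps1 (r : ℝ) (z : ℂ) : ℂ :=
  if r < 1 / 6 then -2 / Complex.sqrt (-I * z) * exp (3 * Real.pi * I / z * (r - 1 / 6) ^ 2)
  else if r < 5 / 6 then 0
  else -2 / Complex.sqrt (-I * z) * exp (3 * Real.pi * I / z * (r - 5 / 6) ^ 2)

/-- The correction term `ε₁(a, b, c; z)` for `0 ≤ a/c < 1`, `a/c ≠ 1/6, 5/6`. -/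
def eps1ABC (a b : ℤ) (c : ℕ) (z : ℂ) : ℂ :=
  if (a / c : ℝ) < 1 / 6 then
    zetaRoot (2 * c) ^ b / Complex.sqrt (-I * z) * exp (3 * Real.pi * I / z * (a / c - 1 / 6) ^ 2)
  else if (a / c : ℝ) < 5 / 6 then 0
  else
    zetaRoot (2 * c) ^ (5 * b) / Complex.sqrt (-I * z) *
      exp (3 * Real.pi * I / z * (a / c - 5 / 6) ^ 2)

/-- The correction term `ε₂(r; z)` for `0 < r < 1`, `r ≠ 1/6, 5/6`, where `r = a/c`. -/
def eps2 (r : ℝ) (z : ℂ) : ℂ :=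
  if r < 1 / 6 then 2 * exp (-3 * Real.pi * I * z * (r - 1 / 6) ^ 2)
  else if r < 5 / 6 then 0
  else 2 * exp (-3 * Real.pi * I * z * (r - 5 / 6) ^ 2)

/-- The correction term `ε₂(a, b, c; z)` for `0 ≤ a/c < 1`, `a/c ≠ 1/6, 5/6`. -/
def eps2ABC (a b : ℤ) (c : ℕ) (z : ℂ) : ℂ :=
  if (a / c : ℝ) < 1 / 6 then
    2 * zetaRoot c ^ (-2 * b) * exp (-3 * Real.pi * I * z * (a / c - 1 / 6) ^ 2)
  else if (a / c : ℝ) < 5 / 6 then 0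
  else 2 * exp (-3 * Real.pi * I * z * (a / c - 5 / 6) ^ 2)

end

/-!
All four identities are instances of one integral identity of Zwegers for the unary theta functions
`θ_{μ,b}(t) = ∑ (n + μ) exp (2πi(n + μ)b) exp (-πt(n + μ)²)` (`unaryTheta`). Put
`φ_{μ,b}(X) = exp (μ(X + 2πib)) / (1 - exp (X + 2πib))` (`mordellKernel`). For `0 < μ < 1`, `b ∉ ℤ`
and `Im w > 0`,
`i exp (2πiμb) ∫_0^∞ θ_{b,-μ}(s) / √(s - iw) ds = 2 ∫_ℝ exp (πiwx²) φ_{μ,b}(2πx) dx`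
(`halfPeriod_unaryTheta`). Indeed `1/√(s - iw) = ∫_ℝ exp (-π(s - iw)x²) dx`, and Fubini leaves the
Laplace transform of `θ_{b,-μ}` at `πx²`. The modular transformation `s ↦ 1/s` turns every term of
the theta series into an inverse Gaussian density, of mass `exp (-2πx|n + μ|)`, and these masses sum
up to two geometric series with total `φ_{μ,b}(2πx) + φ_{μ,b}(-2πx)`
(`integral_unaryTheta_mul_exp`).
Fubini applies because a theta function with nonintegral characteristics decays exponentially at
both cusps (`integrableOn_unaryTheta`).

Rotating the line of integration by the identity theorem (`integral_gaussKernel_rotate`) gives the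
same statement for `∫_ℝ exp (-3αx²/2) φ_{μ,b}(3αx) dx` with `w = 2πi/(3α)`. The integrand of
`J(a, b, c; α)` is a combination of two such integrands, with second parameter `1/2 - 3b/c` and
first parameters `a/c + 1/6` and `a/c - 1/6` (`mordellIntegrandABC_eq`). As `c` is odd, none of
these three numbers is an integer. If `a/c > 5/6` or `a/c < 1/6`, one of the first parameters lies
outside `(0, 1)`; moving it back by `1` costs a Gaussian integral, which is the correction term,
whereas the theta side is periodic (`integral_pairIntegrand`).

For `α = 2πi/z` one has `w = z/3` and the theta functions combine to `Θ₁` (`Theta1_eq_dualPair`);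
for `α = -2πiz` one has `w = -1/(3z)`, and after the substitution `t ↦ 1/t` in the period integral
they combine to `Θ₂` (`Theta2_eq_directPair`). This proves the identities for `J(a, b, c; α)`, and
the argument also covers `b = 0`. The identities for `J(a/c; α)` are this case: folding the integral
at `0` gives `J(a, 0, c; α) = 2 J(a/c; α)` (`mordellJABC_zero`), and on the imaginary axis
`Θ₁(a, 0, c)` is a multiple of `Θ(a/c)`, and `Θ₁(0, -a, c)` one of `Θ₂(a, 0, c)`, because `Θ₁` and
`Θ₂` coincide up to exchanging their parameters (`dualPair_eq_directPair`).
-/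

open Filter Topology

/-! ### The principal square root -/

lemma Complex.sqrt_sq (a : ℂ) : Complex.sqrt a ^ 2 = a := cpow_ofNat_inv_pow a 2

lemma Complex.sqrt_ne_zero {a : ℂ} (ha : a ≠ 0) : Complex.sqrt a ≠ 0 := by
  intro h
  apply ha
  rw [← Complex.sqrt_sq a, h]; simp

lemma Complex.sqrt_ofReal {x : ℝ} (hx : 0 ≤ x) : Complex.sqrt (x : ℂ) = (√x : ℝ) := by
  rw [Complex.sqrt, Real.sqrt_eq_rpow, ofReal_cpow hx]; norm_num

lemma Complex.norm_sqrt (a : ℂ) : ‖Complex.sqrt a‖ = √‖a‖ := by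
  rw [← Real.sqrt_sq (norm_nonneg (Complex.sqrt a)), ← norm_pow, Complex.sqrt_sq]

/-- On the right half plane the arguments add up to less than `π`, so no branch is crossed. -/
lemma Complex.sqrt_mul {a b : ℂ} (ha : 0 < a.re) (hb : 0 < b.re) :
    Complex.sqrt (a * b) = Complex.sqrt a * Complex.sqrt b := by
  have ha0 : a ≠ 0 := by rintro rfl; simp at ha
  have hb0 : b ≠ 0 := by rintro rfl; simp at hb
  have h1 := Complex.abs_arg_lt_pi_div_two_iff.2 (Or.inl ha)
  have h2 := Complex.abs_arg_lt_pi_div_two_iff.2 (Or.inl hb)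
  rw [abs_lt] at h1 h2
  rw [Complex.sqrt, Complex.sqrt, Complex.sqrt, cpow_def_of_ne_zero ha0, cpow_def_of_ne_zero hb0,
    cpow_def_of_ne_zero (mul_ne_zero ha0 hb0),
    Complex.log_mul ha0 hb0 ⟨by linarith, by linarith⟩, add_mul, exp_add]

lemma Complex.sqrt_ofReal_mul {l : ℝ} (hl : 0 < l) {a : ℂ} (ha : 0 < a.re) :
    Complex.sqrt (l * a) = (√l : ℝ) * Complex.sqrt a := by
  rw [Complex.sqrt_mul (by simpa using hl) ha, Complex.sqrt_ofReal hl.le]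

lemma Complex.sqrt_inv {a : ℂ} (ha : 0 < a.re) : Complex.sqrt a⁻¹ = (Complex.sqrt a)⁻¹ := by
  refine inv_cpow _ _ fun h => ?_
  have h1 := Complex.abs_arg_lt_pi_div_two_iff.2 (Or.inl ha)
  rw [h, abs_of_pos Real.pi_pos] at h1
  linarith [Real.pi_pos]

/-! ### Gaussian and inverse Gaussian integrals -/

lemma integral_exp_neg_pi_mul_sq {a : ℂ} (ha : 0 < a.re) :
    ∫ x : ℝ, exp (-Real.pi * a * x ^ 2) = (Complex.sqrt a)⁻¹ := by
  have h := integral_gaussian_complex (b := Real.pi * a) (by simpa using mul_pos Real.pi_pos ha)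
  have h0 : (Real.pi : ℂ) ≠ 0 := by exact_mod_cast Real.pi_ne_zero
  have ha0 : a ≠ 0 := by rintro rfl; simp at ha
  rw [← Complex.sqrt_inv ha, Complex.sqrt]
  convert h using 2
  · simp [neg_mul]
  · field_simp
  · norm_num

/-- The primitive `u ↦ ∫_0^u exp(-π v²) dv` of the normalised Gaussian. -/
noncomputable def gaussPrimitive (u : ℝ) : ℝ := ∫ v in (0 : ℝ)..u, Real.exp (-Real.pi * v ^ 2)

lemma hasDerivAt_gaussPrimitive (u : ℝ) :
    HasDerivAt gaussPrimitive (Real.exp (-Real.pi * u ^ 2)) u := by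
  have hc : Continuous fun v : ℝ => Real.exp (-Real.pi * v ^ 2) := by fun_prop
  exact intervalIntegral.integral_hasDerivAt_right (hc.intervalIntegrable _ _)
    (hc.stronglyMeasurableAtFilter _ _) hc.continuousAt

lemma tendsto_gaussPrimitive_atTop : Tendsto gaussPrimitive atTop (𝓝 (1 / 2)) := by
  have h := intervalIntegral_tendsto_integral_Ioi (μ := volume)
    (f := fun v : ℝ => Real.exp (-Real.pi * v ^ 2)) 0
    (integrable_exp_neg_mul_sq Real.pi_pos).integrableOn tendsto_id
  rw [integral_gaussian_Ioi, div_self Real.pi_ne_zero, Real.sqrt_one] at h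
  exact h

lemma gaussPrimitive_neg (u : ℝ) : gaussPrimitive (-u) = -gaussPrimitive u := by
  have h := intervalIntegral.integral_comp_neg (a := 0) (b := u)
    (f := fun v : ℝ => Real.exp (-Real.pi * v ^ 2))
  simp only [neg_sq, neg_zero] at h
  rw [gaussPrimitive, gaussPrimitive, h, intervalIntegral.integral_symm]

lemma tendsto_gaussPrimitive_atBot : Tendsto gaussPrimitive atBot (𝓝 (-(1 / 2))) := by
  have h := (tendsto_gaussPrimitive_atTop.comp tendsto_neg_atBot_atTop).neg
  refine h.congr fun u => ?_
  simp [gaussPrimitive_neg]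

/-- The density of the inverse Gaussian distribution, without its normalising constant
`exp (2πxy)`. -/
noncomputable def invGauss (x y s : ℝ) : ℝ :=
  y / (s * √s) * Real.exp (-Real.pi * y ^ 2 / s - Real.pi * x ^ 2 * s)

/-- The total mass of the inverse Gaussian density. With `K = exp (4πxy)` and `g` the Gaussian
primitive, `exp (-2πxy) (g (x√s - y/√s) - K g (x√s + y/√s))` is an explicit primitive. -/
lemma integral_invGauss {x y : ℝ} (hx : 0 < x) (hy : 0 < y) :
    IntegrableOn (invGauss x y) (Set.Ioi 0) ∧
      ∫ s in Set.Ioi (0 : ℝ), invGauss x y s = Real.exp (-2 * Real.pi * x * y) := by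
  set K : ℝ := Real.exp (4 * Real.pi * x * y) with hK
  set F : ℝ → ℝ := fun s => Real.exp (-2 * Real.pi * x * y) *
    (gaussPrimitive (x * √s - y / √s) - K * gaussPrimitive (x * √s + y / √s)) with hF
  have hsq0 : Tendsto (fun s : ℝ => √s) (𝓝[>] 0) (𝓝[>] 0) := by
    refine tendsto_nhdsWithin_iff.2 ⟨?_, ?_⟩
    · have : Tendsto (fun s : ℝ => √s) (𝓝 0) (𝓝 √0) := Real.continuous_sqrt.tendsto 0
      rw [Real.sqrt_zero] at this
      exact this.mono_left nhdsWithin_le_nhds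
    · filter_upwards [self_mem_nhdsWithin] with s hs using Real.sqrt_pos.2 hs
  have hinv : Tendsto (fun s : ℝ => y / √s) (𝓝[>] 0) atTop := by
    simp_rw [div_eq_mul_inv]
    exact (tendsto_inv_nhdsGT_zero.comp hsq0).const_mul_atTop hy
  have hxs : Tendsto (fun s : ℝ => x * √s) (𝓝[>] 0) (𝓝 0) := by
    simpa using (hsq0.mono_right nhdsWithin_le_nhds).const_mul x
  have hinvT : Tendsto (fun s : ℝ => y / √s) atTop (𝓝 0) :=
    Real.tendsto_sqrt_atTop.const_div_atTop y
  have hxsT : Tendsto (fun s : ℝ => x * √s) atTop atTop :=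
    Real.tendsto_sqrt_atTop.const_mul_atTop hx
  have lim0 : Tendsto F (𝓝[>] 0)
      (𝓝 (Real.exp (-2 * Real.pi * x * y) * (-(1 / 2) - K * (1 / 2)))) := by
    refine ((Tendsto.sub (tendsto_gaussPrimitive_atBot.comp ?_)
      ((tendsto_gaussPrimitive_atTop.comp ?_).const_mul K))).const_mul _
    · simp_rw [sub_eq_add_neg]
      exact hxs.add_atBot (tendsto_neg_atTop_atBot.comp hinv)
    · exact hxs.add_atTop hinv
  have limT : Tendsto F atTop
      (𝓝 (Real.exp (-2 * Real.pi * x * y) * (1 / 2 - K * (1 / 2)))) := by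
    refine ((Tendsto.sub (tendsto_gaussPrimitive_atTop.comp ?_)
      ((tendsto_gaussPrimitive_atTop.comp ?_).const_mul K))).const_mul _
    · simp_rw [sub_eq_add_neg]
      exact hxsT.atTop_add hinvT.neg
    · exact hxsT.atTop_add hinvT
  have hder : ∀ s ∈ Set.Ioi (0 : ℝ), HasDerivAt F (invGauss x y s) s := by
    intro s hs
    have hs : 0 < s := hs
    have hr : 0 < √s := Real.sqrt_pos.2 hs
    have hrr : √s ^ 2 = s := Real.sq_sqrt hs.le
    have d1 : HasDerivAt (fun s : ℝ => √s) (1 / (2 * √s)) s := Real.hasDerivAt_sqrt hs.ne'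
    have d2 : HasDerivAt (fun s : ℝ => y / √s) (-(y / (2 * (s * √s)))) s := by
      refine ((hasDerivAt_const s y).div d1 hr.ne').congr_deriv ?_
      rw [hrr]; field_simp; ring
    have dm := (hasDerivAt_gaussPrimitive (x * √s - y / √s)).comp s ((d1.const_mul x).sub d2)
    have dp := (hasDerivAt_gaussPrimitive (x * √s + y / √s)).comp s ((d1.const_mul x).add d2)
    have := (dm.sub (dp.const_mul K)).const_mul (Real.exp (-2 * Real.pi * x * y))
    refine this.congr_deriv ?_
    have e1 : Real.exp (-2 * Real.pi * x * y) * Real.exp (-Real.pi * (x * √s - y / √s) ^ 2) =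
        Real.exp (-Real.pi * y ^ 2 / s - Real.pi * x ^ 2 * s) := by
      rw [← Real.exp_add]; congr 1
      have : s = √s ^ 2 := hrr.symm
      generalize √s = r at *
      subst this; field_simp; ring
    have e2 : Real.exp (-2 * Real.pi * x * y) * (K * Real.exp (-Real.pi * (x * √s + y / √s) ^ 2)) =
        Real.exp (-Real.pi * y ^ 2 / s - Real.pi * x ^ 2 * s) := by
      rw [hK, ← Real.exp_add, ← Real.exp_add]; congr 1
      have : s = √s ^ 2 := hrr.symm
      generalize √s = r at *
      subst this; field_simp; ring
    rw [invGauss]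
    linear_combination (x * (1 / (2 * √s)) - -(y / (2 * (s * √s)))) * e1 -
      (x * (1 / (2 * √s)) + -(y / (2 * (s * √s)))) * e2
  have hnn : ∀ s ∈ Set.Ioi (0 : ℝ), 0 ≤ invGauss x y s := fun s hs => by
    have hs : 0 < s := hs
    unfold invGauss; positivity
  -- `F` is extended by its limit at the left end point
  set G : ℝ → ℝ := Function.update F 0 (Real.exp (-2 * Real.pi * x * y) * (-(1 / 2) - K * (1 / 2)))
    with hG
  have hGF : ∀ s : ℝ, s ≠ 0 → G =ᶠ[𝓝 s] F := fun s hs => by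
    filter_upwards [isOpen_ne.mem_nhds hs] with u hu using Function.update_of_ne hu _ _
  have hGc : ContinuousWithinAt G (Set.Ici 0) 0 := by
    rw [hG, continuousWithinAt_update_same, Set.Ici_sdiff_left]
    exact lim0
  have hGd : ∀ s ∈ Set.Ioi (0 : ℝ), HasDerivAt G (invGauss x y s) s := fun s hs =>
    (hder s hs).congr_of_eventuallyEq (hGF s (ne_of_gt hs))
  have hGT : Tendsto G atTop (𝓝 (Real.exp (-2 * Real.pi * x * y) * (1 / 2 - K * (1 / 2)))) := by
    refine limT.congr' ?_
    filter_upwards [eventually_gt_atTop 0] with s hs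
    exact (Function.update_of_ne hs.ne' _ _).symm
  refine ⟨integrableOn_Ioi_deriv_of_nonneg hGc hGd hnn hGT, ?_⟩
  rw [integral_Ioi_of_hasDerivAt_of_nonneg hGc hGd hnn hGT, hG, Function.update_self]
  ring

/-! ### Unary theta functions of weight `3/2` -/

/-- The `n`-th term of the theta series `unaryTheta μ b t`. -/
noncomputable def unaryThetaTerm (μ b t : ℝ) (n : ℤ) : ℂ :=
  (n + μ) * exp (2 * Real.pi * I * (n + μ) * b) * exp (-Real.pi * t * (n + μ) ^ 2)

/-- The unary theta function `∑ (n + μ) exp (2πi(n + μ)b) exp (-πt(n + μ)²)` of weight `3/2` with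
characteristics `μ`, `b`, at the point `τ = it` of the imaginary axis. Only that axis matters
here, so the variable is the real number `t`. -/
noncomputable def unaryTheta (μ b t : ℝ) : ℂ := ∑' n : ℤ, unaryThetaTerm μ b t n

lemma norm_unaryThetaTerm (μ b t : ℝ) (n : ℤ) :
    ‖unaryThetaTerm μ b t n‖ = |n + μ| * Real.exp (-Real.pi * t * (n + μ) ^ 2) := by
  have h1 : (2 * Real.pi * I * (n + μ) * b : ℂ) = ((2 * Real.pi * (n + μ) * b : ℝ) : ℂ) * I := by
    push_cast; ring
  have h2 : (-Real.pi * t * (n + μ) ^ 2 : ℂ) = ((-Real.pi * t * (n + μ) ^ 2 : ℝ) : ℂ) := by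
    push_cast; ring
  have h3 : (n + μ : ℂ) = ((n + μ : ℝ) : ℂ) := by push_cast; ring
  rw [unaryThetaTerm, norm_mul, norm_mul, h1, norm_exp_ofReal_mul_I, h2, ← ofReal_exp, h3,
    norm_real, norm_real, Real.norm_eq_abs, Real.norm_eq_abs, Real.abs_exp, mul_one]

lemma summable_abs_mul_exp (μ : ℝ) {t : ℝ} (ht : 0 < t) :
    Summable fun n : ℤ => |n + μ| * Real.exp (-Real.pi * t * (n + μ) ^ 2) := by
  have h1 := summable_pow_mul_jacobiTheta₂_term_bound (t * |μ|) ht 1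
  have h0 := (summable_pow_mul_jacobiTheta₂_term_bound (t * |μ|) ht 0).mul_left |μ|
  refine Summable.of_nonneg_of_le (fun n => by positivity) (fun n => ?_) (h1.add h0)
  have hn : (|(n + μ : ℝ)|) ≤ |(n : ℝ)| + |μ| := abs_add_le _ _
  have he : Real.exp (-Real.pi * t * (n + μ) ^ 2) ≤
      Real.exp (-Real.pi * (t * n ^ 2 - 2 * (t * |μ|) * |(n : ℝ)|)) := by
    apply Real.exp_le_exp.2
    have h2 : -(n * μ) ≤ |μ| * |(n : ℝ)| := by
      rw [← abs_mul, mul_comm μ]; exact neg_le_abs _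
    have h3 : 0 ≤ Real.pi * t := by positivity
    nlinarith [mul_le_mul_of_nonneg_left h2 h3, mul_nonneg h3 (sq_nonneg μ)]
  calc _ ≤ (|(n : ℝ)| + |μ|) * Real.exp (-Real.pi * (t * n ^ 2 - 2 * (t * |μ|) * |(n : ℝ)|)) := by
        gcongr
    _ = _ := by push_cast; ring

lemma summable_unaryThetaTerm (μ b : ℝ) {t : ℝ} (ht : 0 < t) :
    Summable (unaryThetaTerm μ b t) := by
  refine Summable.of_norm ?_
  simpa only [norm_unaryThetaTerm] using summable_abs_mul_exp μ ht

/-- `unaryTheta` in terms of the Jacobi theta function and its derivative; this transports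
continuity and the modular transformation. -/
lemma unaryTheta_eq_jacobiTheta₂ (μ b : ℝ) {t : ℝ} (ht : 0 < t) :
    unaryTheta μ b t = exp (2 * Real.pi * I * μ * b - Real.pi * t * μ ^ 2) *
      (jacobiTheta₂' (b + μ * (I * t)) (I * t) / (2 * Real.pi * I) +
        μ * jacobiTheta₂ (b + μ * (I * t)) (I * t)) := by
  have him : 0 < (I * t : ℂ).im := by simpa using ht
  have h0 : (Real.pi : ℂ) ≠ 0 := by exact_mod_cast Real.pi_ne_zero
  have h := (((hasSum_jacobiTheta₂'_term (b + μ * (I * t)) him).div_const (2 * Real.pi * I)).add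
    ((hasSum_jacobiTheta₂_term (b + μ * (I * t)) him).mul_left (μ : ℂ))).mul_left
      (exp (2 * Real.pi * I * μ * b - Real.pi * t * μ ^ 2))
  rw [← h.tsum_eq]
  refine tsum_congr fun n => ?_
  have e : exp (2 * Real.pi * I * (n + μ) * b) * exp (-Real.pi * t * (n + μ) ^ 2) =
      exp (2 * Real.pi * I * μ * b - Real.pi * t * μ ^ 2) *
        exp (2 * Real.pi * I * n * (b + μ * (I * t)) + Real.pi * I * n ^ 2 * (I * t)) := by
    rw [← exp_add, ← exp_add]; congr 1
    linear_combination (-2 * Real.pi * n * μ * t - Real.pi * n ^ 2 * t) * I_sq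
  rw [unaryThetaTerm, jacobiTheta₂'_term, jacobiTheta₂_term, mul_assoc, e]
  field_simp [I_ne_zero]

/-- The modular transformation of `unaryTheta` under `τ ↦ -1/τ`; it exchanges the two
characteristics. -/
lemma unaryTheta_functional_equation (μ b : ℝ) {t : ℝ} (ht : 0 < t) :
    unaryTheta μ b t =
      I * exp (2 * Real.pi * I * μ * b) / (t * √t : ℝ) * unaryTheta b (-μ) t⁻¹ := by
  have h0 : (Real.pi : ℂ) ≠ 0 := by exact_mod_cast Real.pi_ne_zero
  have ht0 : (t : ℂ) ≠ 0 := by exact_mod_cast ht.ne'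
  have hr0 : ((√t : ℝ) : ℂ) ≠ 0 := by exact_mod_cast (Real.sqrt_pos.2 ht).ne'
  have him : 0 < (-1 / (I * t) : ℂ).im := by
    have : (-1 / (I * t) : ℂ) = ((t⁻¹ : ℝ) : ℂ) * I := by
      push_cast; field_simp; rw [I_sq]
    rw [this]; simpa using ht
  set Z : ℂ := b + μ * (I * t) with hZ
  have hA : (-I * (I * t) : ℂ) ^ (1 / 2 : ℂ) = (√t : ℝ) := by
    rw [show (-I * (I * t) : ℂ) = (t : ℂ) by linear_combination (-t : ℂ) * I_sq,
      Real.sqrt_eq_rpow, ofReal_cpow ht.le]; norm_num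
  have h := (((hasSum_jacobiTheta₂'_term (Z / (I * t)) him).div_const (2 * Real.pi * I)).sub
    ((hasSum_jacobiTheta₂_term (Z / (I * t)) him).mul_left (b : ℂ)))
  rw [unaryTheta_eq_jacobiTheta₂ μ b ht, ← hZ, jacobiTheta₂'_functional_equation,
    jacobiTheta₂_functional_equation Z (I * t), hA]
  have hS : jacobiTheta₂' (Z / (I * t)) (-1 / (I * t)) / (2 * Real.pi * I) -
      b * jacobiTheta₂ (Z / (I * t)) (-1 / (I * t)) =
      -exp (Real.pi * I * Z ^ 2 / (I * t) + Real.pi * t * μ ^ 2) * unaryTheta b (-μ) t⁻¹ := by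
    rw [← h.tsum_eq, unaryTheta, ← tsum_mul_left, ← (Equiv.neg ℤ).tsum_eq]
    refine tsum_congr fun n => ?_
    have e : exp (Real.pi * I * Z ^ 2 / (I * t) + Real.pi * t * μ ^ 2) *
        (exp (2 * Real.pi * I * (n + b) * (-μ : ℝ)) *
          exp (-Real.pi * (t⁻¹ : ℝ) * (n + b) ^ 2)) =
        exp (2 * Real.pi * I * (-n : ℤ) * (Z / (I * t)) +
          Real.pi * I * (-n : ℤ) ^ 2 * (-1 / (I * t))) := by
      rw [← exp_add, ← exp_add]; congr 1
      rw [hZ]; push_cast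
      field_simp
      linear_combination (μ ^ 2 * t ^ 2 : ℂ) * I_sq
    rw [unaryThetaTerm, Equiv.neg_apply, jacobiTheta₂'_term, jacobiTheta₂_term, neg_mul,
      mul_assoc (n + b : ℂ), mul_left_comm, e]
    push_cast
    field_simp [I_ne_zero]
    ring
  have e2 : exp (2 * Real.pi * I * μ * b) = exp (2 * Real.pi * I * μ * b - Real.pi * t * μ ^ 2) *
      exp (-Real.pi * I * Z ^ 2 / (I * t)) *
        exp (Real.pi * I * Z ^ 2 / (I * t) + Real.pi * t * μ ^ 2) := by
    rw [← exp_add, ← exp_add]; congr 1; ring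
  rw [e2]
  have : ∀ u v E : ℂ, 1 / ((√t : ℝ) : ℂ) * E / (I * t) * (u - 2 * Real.pi * I * Z * v) /
      (2 * Real.pi * I) + μ * (1 / ((√t : ℝ) : ℂ) * E * v) =
      E / ((√t : ℝ) * (I * t)) * (u / (2 * Real.pi * I) - b * v) := by
    intro u v E
    rw [hZ]; field_simp [I_ne_zero]; ring
  rw [this, hS]
  push_cast
  field_simp [I_ne_zero]
  rw [I_sq]; ring

lemma continuousOn_unaryTheta (μ b : ℝ) : ContinuousOn (unaryTheta μ b) (Set.Ioi 0) := by
  have hc : ContinuousOn (fun t : ℝ => exp (2 * Real.pi * I * μ * b - Real.pi * t * μ ^ 2) *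
      (jacobiTheta₂' (b + μ * (I * t)) (I * t) / (2 * Real.pi * I) +
        μ * jacobiTheta₂ (b + μ * (I * t)) (I * t))) (Set.Ioi 0) := by
    intro t ht
    refine ContinuousAt.continuousWithinAt ?_
    have him : 0 < (I * t : ℂ).im := by simpa using ht
    have hp : ContinuousAt (fun t : ℝ => ((b + μ * (I * t) : ℂ), (I * t : ℂ))) t := by fun_prop
    have h1 : ContinuousAt (fun t : ℝ => jacobiTheta₂ (b + μ * (I * t)) (I * t)) t :=
      ContinuousAt.comp (f := fun t : ℝ => ((b + μ * (I * t) : ℂ), (I * t : ℂ)))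
        (continuousAt_jacobiTheta₂ (b + μ * (I * t)) him) hp
    have h2 : ContinuousAt (fun t : ℝ => jacobiTheta₂' (b + μ * (I * t)) (I * t)) t :=
      ContinuousAt.comp (f := fun t : ℝ => ((b + μ * (I * t) : ℂ), (I * t : ℂ)))
        (continuousAt_jacobiTheta₂' (b + μ * (I * t)) him) hp
    exact (by fun_prop : Continuous fun t : ℝ =>
      exp (2 * Real.pi * I * μ * b - Real.pi * t * μ ^ 2)).continuousAt.mul
        ((h2.div_const _).add (h1.const_mul _))
  exact hc.congr fun t ht => unaryTheta_eq_jacobiTheta₂ μ b ht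

/-- A real number that is not an integer has positive distance from `ℤ`. -/
lemma exists_pos_le_abs_add {μ : ℝ} (hμ : ∀ n : ℤ, (n : ℝ) + μ ≠ 0) :
    ∃ δ > 0, ∀ n : ℤ, δ ≤ |(n : ℝ) + μ| := by
  refine ⟨|-μ - round (-μ)|, abs_pos.2 fun h => hμ (round (-μ)) (by linarith), fun n => ?_⟩
  rw [abs_sub_comm (-μ)]
  have := round_le (-μ) n
  rwa [abs_sub_comm, abs_sub_comm (-μ), sub_neg_eq_add, sub_neg_eq_add] at *

/-- Exponential decay at infinity of a theta series without constant term. -/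
lemma exists_norm_unaryTheta_le {μ : ℝ} (b : ℝ) (hμ : ∀ n : ℤ, (n : ℝ) + μ ≠ 0) :
    ∃ C ε : ℝ, 0 < ε ∧ ∀ t : ℝ, 1 ≤ t → ‖unaryTheta μ b t‖ ≤ C * Real.exp (-ε * t) := by
  obtain ⟨δ, hδ, hle⟩ := exists_pos_le_abs_add hμ
  refine ⟨∑' n : ℤ, |n + μ| * Real.exp (-Real.pi * (1 / 2) * (n + μ) ^ 2),
    Real.pi * δ ^ 2 / 2, by positivity, fun t ht => ?_⟩
  have hs := summable_abs_mul_exp μ (t := 1 / 2) (by norm_num)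
  rw [← tsum_mul_right]
  refine tsum_of_norm_bounded (hs.mul_right _).hasSum fun n => ?_
  rw [norm_unaryThetaTerm, mul_assoc |(n + μ : ℝ)|, ← Real.exp_add]
  gcongr
  have h1 : δ ^ 2 ≤ (n + μ) ^ 2 := by
    rw [← sq_abs (n + μ)]; gcongr; exact hle n
  have h2 : δ ^ 2 * t + (n + μ) ^ 2 ≤ 2 * (t * (n + μ) ^ 2) := by
    nlinarith [mul_le_mul_of_nonneg_right h1 (by linarith : 0 ≤ t),
      mul_le_mul_of_nonneg_right ht (sq_nonneg (n + μ))]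
  nlinarith [mul_le_mul_of_nonneg_left h2 Real.pi_pos.le]

/-- If neither characteristic is an integer, the theta function decays exponentially at infinity
and, by the modular transformation, also at `0`. -/
lemma integrableOn_unaryTheta {μ b : ℝ} (hμ : ∀ n : ℤ, (n : ℝ) + μ ≠ 0)
    (hb : ∀ n : ℤ, (n : ℝ) + b ≠ 0) : IntegrableOn (unaryTheta μ b) (Set.Ioi 0) := by
  have hm := (continuousOn_unaryTheta μ b).aestronglyMeasurable measurableSet_Ioi (μ := volume)
  obtain ⟨C, ε, hε, hC⟩ := exists_norm_unaryTheta_le b hμ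
  obtain ⟨C', ε', hε', hC'⟩ := exists_norm_unaryTheta_le (-μ) hb
  rw [← Set.Ioc_union_Ioi_eq_Ioi zero_le_one]
  refine IntegrableOn.union ?_ ?_
  · refine Integrable.mono' (g := fun _ => 2 * C' / ε' ^ 2) (integrableOn_const (by simp))
      (hm.mono_set Set.Ioc_subset_Ioi_self) ?_
    refine (ae_restrict_iff' measurableSet_Ioc).2 (Eventually.of_forall fun t ht => ?_)
    have ht0 : 0 < t := ht.1
    have hinv : 1 ≤ t⁻¹ := (one_le_inv₀ ht0).2 ht.2
    have hC0 : 0 ≤ C' := by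
      have := (norm_nonneg _).trans (hC' 1 le_rfl)
      exact nonneg_of_mul_nonneg_left this (Real.exp_pos _)
    have hn : ‖I * exp (2 * Real.pi * I * μ * b) / (t * √t : ℝ)‖ = 1 / (t * √t) := by
      rw [norm_div, norm_mul, norm_I, one_mul,
        show (2 * Real.pi * I * μ * b : ℂ) = ((2 * Real.pi * μ * b : ℝ) : ℂ) * I by
          push_cast; ring, norm_exp_ofReal_mul_I, norm_real, Real.norm_of_nonneg (by positivity)]
    rw [unaryTheta_functional_equation μ b ht0, norm_mul, hn]
    -- the factor `t⁻² ≥ t^(-3/2)` is absorbed by the exponential decay in `t⁻¹`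
    have h1 : t ≤ √t := Real.le_sqrt_of_sq_le (by nlinarith [ht.2])
    have h2 : 1 / (t * √t) ≤ t⁻¹ ^ 2 := by
      rw [inv_pow, ← one_div]
      gcongr
      nlinarith
    have h3 : Real.exp (-ε' * t⁻¹) ≤ 2 / (ε' * t⁻¹) ^ 2 := by
      rw [neg_mul, Real.exp_neg, ← one_div, div_le_div_iff₀ (Real.exp_pos _) (by positivity)]
      have := Real.quadratic_le_exp_of_nonneg (x := ε' * t⁻¹) (by positivity)
      nlinarith [(by positivity : 0 ≤ ε' * t⁻¹)]
    calc 1 / (t * √t) * ‖unaryTheta b (-μ) t⁻¹‖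
        ≤ t⁻¹ ^ 2 * (C' * (2 / (ε' * t⁻¹) ^ 2)) := by
          gcongr
          exact (hC' _ hinv).trans (by gcongr)
      _ = 2 * C' / ε' ^ 2 := by field_simp
  · have hi : IntegrableOn (fun t : ℝ => C * Real.exp (-ε * t)) (Set.Ioi 1) :=
      (integrableOn_exp_mul_Ioi (by linarith) 1).const_mul C
    refine Integrable.mono' hi
      (hm.mono_set (Set.Ioi_subset_Ioi zero_le_one)) ?_
    exact (ae_restrict_iff' measurableSet_Ioi).2
      (Eventually.of_forall fun t ht => hC t (le_of_lt ht))

/-! ### The Mordell kernel and its Gaussian integrals -/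

/-- Holomorphy of a parametric integral whose integrand is holomorphic in the parameter and locally
dominated: the Cauchy estimate provides the domination of the derivative. -/
lemma differentiableOn_integral_of_locally_dominated {U : Set ℂ} {F : ℂ → ℝ → ℂ}
    (hF : ∀ x, DifferentiableOn ℂ (fun α => F α x) U)
    (hm : ∀ α ∈ U, AEStronglyMeasurable (F α))
    (hb : ∀ α₀ ∈ U, ∃ ε > 0, Metric.ball α₀ ε ⊆ U ∧ ∃ B : ℝ → ℝ, Integrable B ∧
      ∀ α ∈ Metric.ball α₀ ε, ∀ x, ‖F α x‖ ≤ B x) :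
    DifferentiableOn ℂ (fun α => ∫ x, F α x) U := by
  intro α₀ hα₀
  obtain ⟨ε, hε, hU, B, hB, hle⟩ := hb α₀ hα₀
  have hd : ∀ α ∈ Metric.ball α₀ ε, ∀ x, HasDerivAt (fun α => F α x) (deriv (fun α => F α x) α) α :=
    fun α hα x => ((hF x).differentiableAt
      (mem_of_superset (Metric.isOpen_ball.mem_nhds hα) hU)).hasDerivAt
  have hself : α₀ ∈ Metric.ball α₀ ε := Metric.mem_ball_self hε
  -- the derivative is measurable in `x` as a limit of difference quotients
  have hm' : AEStronglyMeasurable (fun x => deriv (fun α => F α x) α₀) := by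
    have ht : Tendsto (fun n : ℕ => ((ε / 2 / (n + 1) : ℝ) : ℂ)) atTop (𝓝[≠] 0) := by
      refine tendsto_nhdsWithin_iff.2 ⟨?_, Eventually.of_forall fun n => ?_⟩
      · have h0 : Tendsto (fun n : ℕ => ε / 2 / ((n : ℝ) + 1)) atTop (𝓝 0) :=
          (tendsto_natCast_atTop_atTop.atTop_add tendsto_const_nhds).const_div_atTop (ε / 2)
        exact_mod_cast (continuous_ofReal.tendsto 0).comp h0
      · exact ofReal_ne_zero.2 (by positivity)
    refine aestronglyMeasurable_of_tendsto_ae atTop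
      (f := fun (n : ℕ) x => ((ε / 2 / (n + 1) : ℝ) : ℂ)⁻¹ •
        (F (α₀ + ((ε / 2 / (n + 1) : ℝ) : ℂ)) x - F α₀ x)) (fun n => ?_) ?_
    · refine AEStronglyMeasurable.const_smul ((hm _ (hU ?_)).sub (hm _ hα₀))
        ((ε / 2 / (n + 1) : ℝ) : ℂ)⁻¹
      rw [mem_ball_iff_norm, add_sub_cancel_left, norm_real, Real.norm_of_nonneg (by positivity)]
      have : ε / 2 / ((n : ℝ) + 1) ≤ ε / 2 := div_le_self (by positivity) (by simp)
      linarith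
    · exact Eventually.of_forall fun x =>
        (hasDerivAt_iff_tendsto_slope_zero.1 (hd α₀ hself x)).comp ht
  have key := hasDerivAt_integral_of_dominated_loc_of_deriv_le (μ := volume)
    (F := F) (F' := fun α x => deriv (fun α => F α x) α) (x₀ := α₀)
    (bound := fun x => B x / (ε / 2)) (Metric.ball_mem_nhds α₀ (half_pos hε)) ?_ ?_ hm' ?_ ?_ ?_
  · exact key.2.differentiableAt.differentiableWithinAt
  · filter_upwards [Metric.ball_mem_nhds α₀ hε] with α hα using hm α (hU hα)
  · exact hB.mono' (hm α₀ hα₀) (Eventually.of_forall fun x => hle α₀ hself x)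
  · refine Eventually.of_forall fun x α hα => ?_
    have hsub : ∀ β ∈ Metric.ball α (ε / 2), β ∈ Metric.ball α₀ ε := fun β hβ => by
      rw [Metric.mem_ball] at *
      linarith [dist_triangle β α α₀]
    have hsub' : ∀ β ∈ Metric.closedBall α (ε / 2), β ∈ Metric.ball α₀ ε := fun β hβ => by
      rw [Metric.mem_ball] at *
      rw [Metric.mem_closedBall] at hβ
      linarith [dist_triangle β α α₀]
    refine norm_deriv_le_of_forall_mem_sphere_norm_le (half_pos hε) ?_
      fun β hβ => hle β (hsub' β (Metric.sphere_subset_closedBall hβ)) x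
    refine DifferentiableOn.diffContOnCl_ball (U := U) (hF x) fun β hβ => hU (hsub' β hβ)
  · exact hB.div_const _
  · exact Eventually.of_forall fun x α hα =>
      hd α (Metric.ball_subset_ball (half_le_self hε.le) hα) x

/-- The kernel `exp (μ(X + 2πib)) / (1 - exp (X + 2πib))` from which the
integrands of the Mordell integrals are built. -/
noncomputable def mordellKernel (μ b : ℝ) (X : ℂ) : ℂ :=
  exp (μ * (X + 2 * Real.pi * I * b)) / (1 - exp (X + 2 * Real.pi * I * b))

/-- The poles of the kernel lie on the imaginary axis, and `X = 0` is not one of them. -/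
lemma one_sub_exp_ne_zero {b : ℝ} (hb : ∀ n : ℤ, (n : ℝ) + b ≠ 0) {γ : ℂ} (hγ : 0 < γ.re)
    (x : ℝ) : 1 - exp (γ * x + 2 * Real.pi * I * b) ≠ 0 := by
  intro h
  obtain ⟨n, hn⟩ := exp_eq_one_iff.1 (sub_eq_zero.1 h).symm
  have hre := congrArg re hn
  have hx : x = 0 := by simpa [hγ.ne'] using hre
  rw [hx, ofReal_zero, mul_zero, zero_add] at hn
  have h2 : (b : ℂ) = n := by
    have h0 : (2 * Real.pi * I : ℂ) ≠ 0 := two_pi_I_ne_zero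
    refine mul_left_cancel₀ h0 ?_
    rw [hn]; ring
  refine hb (-n) ?_
  have : b = n := by exact_mod_cast h2
  rw [this]; push_cast; ring

/-- A bound for the kernel on the line `ℝγ` that is locally uniform in the direction `γ`. -/
lemma exists_norm_mordellKernel_le (μ : ℝ) {b : ℝ} (hb : ∀ n : ℤ, (n : ℝ) + b ≠ 0) {γ₀ : ℂ}
    (hγ₀ : 0 < γ₀.re) : ∃ r > 0, ∃ C R : ℝ, 0 ≤ C ∧ ∀ γ ∈ Metric.ball γ₀ r, 0 < γ.re ∧
      ∀ x : ℝ, ‖mordellKernel μ b (γ * x)‖ ≤ C * Real.exp (R * |x|) := by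
  set r : ℝ := γ₀.re / 2 with hr
  have hre : ∀ γ ∈ Metric.closedBall γ₀ r, r ≤ γ.re ∧ γ.re ≤ 3 * r := fun γ hγ => by
    rw [mem_closedBall_iff_norm] at hγ
    have := (abs_re_le_norm (γ - γ₀)).trans hγ
    rw [sub_re, abs_le] at this
    constructor <;> linarith
  have hr0 : 0 < r := by rw [hr]; linarith
  -- a lower bound of the denominator for bounded `x` comes from compactness
  obtain ⟨m, hm, hmle⟩ : ∃ m > 0, ∀ γ ∈ Metric.closedBall γ₀ r, ∀ x ∈ Set.Icc (-1 : ℝ) 1,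
      m ≤ ‖1 - exp (γ * x + 2 * Real.pi * I * b)‖ := by
    have hcomp : IsCompact (Metric.closedBall γ₀ r ×ˢ Set.Icc (-1 : ℝ) 1) :=
      (isCompact_closedBall _ _).prod isCompact_Icc
    have hcont : Continuous fun p : ℂ × ℝ => ‖1 - exp (p.1 * p.2 + 2 * Real.pi * I * b)‖ := by
      fun_prop
    obtain ⟨p, hp, hmin⟩ := hcomp.exists_isMinOn
      ⟨(γ₀, 0), Metric.mem_closedBall_self hr0.le, by simp⟩ hcont.continuousOn
    refine ⟨_, norm_pos_iff.2 (one_sub_exp_ne_zero hb (hr0.trans_le (hre p.1 hp.1).1) p.2),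
      fun γ hγ x hx => ?_⟩
    exact hmin (Set.mk_mem_prod hγ hx)
  have he : 0 < 1 - Real.exp (-r) := by
    have := Real.exp_lt_one_iff.2 (neg_lt_zero.2 hr0)
    linarith
  have hlow : ∀ γ ∈ Metric.closedBall γ₀ r, ∀ x : ℝ,
      min m (1 - Real.exp (-r)) ≤ ‖1 - exp (γ * x + 2 * Real.pi * I * b)‖ := by
    intro γ hγ x
    by_cases hx : x ∈ Set.Icc (-1 : ℝ) 1
    · exact (min_le_left _ _).trans (hmle γ hγ x hx)
    · refine (min_le_right _ _).trans ?_
      have hn : ‖exp (γ * x + 2 * Real.pi * I * b)‖ = Real.exp (γ.re * x) := by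
        rw [norm_exp]; simp
      have h1 := abs_norm_sub_norm_le 1 (exp (γ * x + 2 * Real.pi * I * b))
      rw [hn, norm_one] at h1
      refine le_trans ?_ h1
      have hγr := (hre γ hγ).1
      rcases lt_or_ge x (-1) with h | h
      · refine le_trans ?_ (le_abs_self _)
        have : Real.exp (γ.re * x) ≤ Real.exp (-r) := Real.exp_le_exp.2 (by nlinarith)
        linarith
      · have hx1 : 1 < x := by
          by_contra h'
          exact hx ⟨h, not_lt.1 h'⟩
        refine le_trans ?_ (neg_le_abs _)
        have h2 : Real.exp r ≤ Real.exp (γ.re * x) := Real.exp_le_exp.2 (by nlinarith)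
        have h3 := Real.add_one_le_exp r
        have h4 := Real.add_one_le_exp (-r)
        linarith
  have hmin : 0 < min m (1 - Real.exp (-r)) := lt_min hm he
  refine ⟨r, hr0, (min m (1 - Real.exp (-r)))⁻¹, |μ| * (3 * r), by positivity, fun γ hγ => ?_⟩
  have hγ' := Metric.ball_subset_closedBall hγ
  refine ⟨hr0.trans_le (hre γ hγ').1, fun x => ?_⟩
  have hnum : ‖exp (μ * (γ * x + 2 * Real.pi * I * b))‖ ≤ Real.exp (|μ| * (3 * r) * |x|) := by
    rw [norm_exp]
    apply Real.exp_le_exp.2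
    have : (μ * (γ * x + 2 * Real.pi * I * b) : ℂ).re = μ * (γ.re * x) := by simp
    rw [this]
    calc μ * (γ.re * x) ≤ |μ * (γ.re * x)| := le_abs_self _
      _ = |μ| * γ.re * |x| := by
        rw [abs_mul, abs_mul, abs_of_pos (hr0.trans_le (hre γ hγ').1), mul_assoc]
      _ ≤ _ := by gcongr; exact (hre γ hγ').2
  rw [mordellKernel, norm_div, div_eq_inv_mul]
  gcongr
  exact hlow γ hγ' x

lemma integrable_exp_mul_abs_sub_sq (R : ℝ) {a : ℝ} (ha : 0 < a) :
    Integrable fun x : ℝ => Real.exp (R * |x|) * Real.exp (-a * x ^ 2) := by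
  have h : ∀ c : ℝ, Integrable fun x : ℝ => Real.exp (-a * x ^ 2 + c * x) := fun c => by
    have := (integrable_cexp_quadratic (b := (a : ℂ)) (by simpa using ha) c 0).norm
    refine this.congr (Eventually.of_forall fun x => ?_)
    simp only [norm_exp]
    congr 1
    simp [← ofReal_pow]
  refine Integrable.mono' ((h R).add (h (-R))) (by fun_prop) (Eventually.of_forall fun x => ?_)
  rw [Real.norm_of_nonneg (by positivity), ← Real.exp_add, Pi.add_apply]
  rcases abs_cases x with ⟨h1, -⟩ | ⟨h1, -⟩ <;> rw [h1]
  · rw [add_comm (R * x)]; linarith [Real.exp_pos (-a * x ^ 2 + -R * x)]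
  · rw [show R * -x + -a * x ^ 2 = -a * x ^ 2 + -R * x by ring]
    linarith [Real.exp_pos (-a * x ^ 2 + R * x)]

/-- The integrand `exp (-A x²) φ (γ x)`, with `φ` the kernel `mordellKernel μ b`. -/
noncomputable def gaussKernel (μ b : ℝ) (A γ : ℂ) (x : ℝ) : ℂ :=
  exp (-A * x ^ 2) * mordellKernel μ b (γ * x)

lemma continuous_gaussKernel (μ : ℝ) {b : ℝ} (hb : ∀ n : ℤ, (n : ℝ) + b ≠ 0) (A : ℂ) {γ : ℂ}
    (hγ : 0 < γ.re) : Continuous (gaussKernel μ b A γ) := by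
  unfold gaussKernel mordellKernel
  refine Continuous.mul (by fun_prop) (Continuous.div (by fun_prop) (by fun_prop) fun x => ?_)
  exact one_sub_exp_ne_zero hb hγ x

lemma norm_exp_neg_mul_sq (A : ℂ) (x : ℝ) : ‖exp (-A * x ^ 2)‖ = Real.exp (-A.re * x ^ 2) := by
  rw [norm_exp]; congr 1; simp [← ofReal_pow]

lemma integrable_gaussKernel (μ : ℝ) {b : ℝ} (hb : ∀ n : ℤ, (n : ℝ) + b ≠ 0) {A γ : ℂ}
    (hA : 0 < A.re) (hγ : 0 < γ.re) : Integrable (gaussKernel μ b A γ) := by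
  obtain ⟨r, hr, C, R, hC, h⟩ := exists_norm_mordellKernel_le μ hb hγ
  refine Integrable.mono' ((integrable_exp_mul_abs_sub_sq R hA).const_mul C)
    (continuous_gaussKernel μ hb A hγ).aestronglyMeasurable (Eventually.of_forall fun x => ?_)
  rw [gaussKernel, norm_mul, norm_exp_neg_mul_sq, ← mul_assoc, mul_comm]
  gcongr
  exact (h γ (Metric.mem_ball_self hr)).2 x

/-- Holomorphic dependence of the Mordell integral on its parameters. -/
lemma differentiableOn_integral_gaussKernel (μ : ℝ) {b : ℝ} (hb : ∀ n : ℤ, (n : ℝ) + b ≠ 0)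
    {U : Set ℂ} (hU : IsOpen U) {A γ : ℂ → ℂ} (hA : DifferentiableOn ℂ A U)
    (hγ : DifferentiableOn ℂ γ U) (hA0 : ∀ α ∈ U, 0 < (A α).re) (hγ0 : ∀ α ∈ U, 0 < (γ α).re) :
    DifferentiableOn ℂ (fun α => ∫ x, gaussKernel μ b (A α) (γ α) x) U := by
  refine differentiableOn_integral_of_locally_dominated (fun x => ?_) (fun α hα =>
    (continuous_gaussKernel μ hb _ (hγ0 α hα)).aestronglyMeasurable) fun α₀ hα₀ => ?_
  · unfold gaussKernel mordellKernel
    refine DifferentiableOn.mul (by fun_prop) (DifferentiableOn.div (by fun_prop) (by fun_prop)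
      fun α hα => one_sub_exp_ne_zero hb (hγ0 α hα) x)
  · obtain ⟨r, hr, C, R, hC, h⟩ := exists_norm_mordellKernel_le μ hb (hγ0 α₀ hα₀)
    have hAc := (hA.continuousOn.continuousAt (hU.mem_nhds hα₀))
    have hγc := (hγ.continuousOn.continuousAt (hU.mem_nhds hα₀))
    have hev : ∀ᶠ α in 𝓝 α₀, α ∈ U ∧ γ α ∈ Metric.ball (γ α₀) r ∧ (A α₀).re / 2 < (A α).re := by
      have h1 : ∀ᶠ α in 𝓝 α₀, γ α ∈ Metric.ball (γ α₀) r := hγc (Metric.ball_mem_nhds _ hr)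
      have h2 : ∀ᶠ α in 𝓝 α₀, (A α₀).re / 2 < (A α).re :=
        (continuous_re.continuousAt.comp hAc).eventually_const_lt (half_lt_self (hA0 α₀ hα₀))
      have h3 : ∀ᶠ α in 𝓝 α₀, α ∈ U := hU.mem_nhds hα₀
      exact h3.and (h1.and h2)
    obtain ⟨ε, hε, hball⟩ := Metric.eventually_nhds_iff_ball.1 hev
    refine ⟨ε, hε, fun α hα => (hball α hα).1, _,
      (integrable_exp_mul_abs_sub_sq R (half_pos (hA0 α₀ hα₀))).const_mul C, fun α hα x => ?_⟩
    obtain ⟨-, h1, h2⟩ := hball α hα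
    rw [gaussKernel, norm_mul, norm_exp_neg_mul_sq, ← mul_assoc, mul_comm]
    gcongr
    exact (h _ h1).2 x

/-- Rotation of the line of integration, `αx = 2πu/3`. For `α > 0` this is a linear substitution,
and both sides are holomorphic in the right half plane. -/
lemma integral_gaussKernel_rotate (μ : ℝ) {b : ℝ} (hb : ∀ n : ℤ, (n : ℝ) + b ≠ 0) {α : ℂ}
    (hα : 0 < α.re) :
    α * ∫ x, gaussKernel μ b (3 / 2 * α) (3 * α) x =
      2 * Real.pi / 3 * ∫ x, gaussKernel μ b (2 * Real.pi ^ 2 / 3 * α⁻¹) (2 * Real.pi) x := by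
  set U : Set ℂ := {α : ℂ | 0 < α.re} with hUdef
  have hU : IsOpen U := isOpen_lt continuous_const continuous_re
  have hne : ∀ α ∈ U, α ≠ 0 := fun α hα h => by simp [hUdef, h] at hα
  have hinv : ∀ α ∈ U, 0 < (α⁻¹).re := fun α hα => by
    rw [inv_re]; exact div_pos hα (normSq_pos.2 (hne α hα))
  have hre : ∀ (k : ℝ) (β : ℂ), 0 < k → 0 < β.re → 0 < ((k : ℂ) * β).re := fun k β hk hβ => by
    rw [re_ofReal_mul]; exact mul_pos hk hβ
  have hd1 : DifferentiableOn ℂ (fun α => α * ∫ x, gaussKernel μ b (3 / 2 * α) (3 * α) x) U := by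
    refine differentiableOn_id.mul (differentiableOn_integral_gaussKernel μ hb hU
      (by fun_prop) (by fun_prop) (fun α hα => ?_) fun α hα => ?_)
    · simpa using hre (3 / 2) α (by norm_num) hα
    · exact_mod_cast hre 3 α (by norm_num) hα
  have hd2 : DifferentiableOn ℂ (fun α : ℂ => 2 * Real.pi / 3 *
      ∫ x, gaussKernel μ b (2 * Real.pi ^ 2 / 3 * α⁻¹) (2 * Real.pi) x) U := by
    refine DifferentiableOn.const_mul (differentiableOn_integral_gaussKernel μ hb hU
      (A := fun α => 2 * Real.pi ^ 2 / 3 * α⁻¹) (γ := fun _ => 2 * Real.pi)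
      ((differentiableOn_id.inv hne).const_mul _) (by fun_prop) (fun α hα => ?_) fun α hα => ?_) _
    · have := hre (2 * Real.pi ^ 2 / 3) _ (by positivity) (hinv α hα)
      push_cast at this
      exact this
    · exact_mod_cast Real.two_pi_pos
  have hreal : ∀ a : ℝ, 0 < a → (a : ℂ) * ∫ x, gaussKernel μ b (3 / 2 * a) (3 * a) x =
      2 * Real.pi / 3 * ∫ x, gaussKernel μ b (2 * Real.pi ^ 2 / 3 * (a : ℂ)⁻¹) (2 * Real.pi) x := by
    intro a ha
    have hpi := Real.pi_pos
    have h := Measure.integral_comp_mul_left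
      (gaussKernel μ b (2 * Real.pi ^ 2 / 3 * (a : ℂ)⁻¹) (2 * Real.pi)) (3 * a / (2 * Real.pi))
    have hfun : (fun x : ℝ => gaussKernel μ b (2 * Real.pi ^ 2 / 3 * (a : ℂ)⁻¹) (2 * Real.pi)
        (3 * a / (2 * Real.pi) * x)) = gaussKernel μ b (3 / 2 * a) (3 * a) := by
      funext x
      have h0 : (Real.pi : ℂ) ≠ 0 := by exact_mod_cast Real.pi_ne_zero
      have ha0 : (a : ℂ) ≠ 0 := by exact_mod_cast ha.ne'
      rw [gaussKernel, gaussKernel]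
      congr 2
      · push_cast; field_simp
      · push_cast; field_simp
    rw [hfun, abs_of_pos (by positivity)] at h
    have h0 : (Real.pi : ℂ) ≠ 0 := by exact_mod_cast Real.pi_ne_zero
    have ha0 : (a : ℂ) ≠ 0 := by exact_mod_cast ha.ne'
    rw [h, real_smul]
    push_cast
    field_simp
  have hconv : IsPreconnected U := (convex_halfSpace_re_gt 0).isPreconnected
  refine (hd1.analyticOnNhd hU).eqOn_of_preconnected_of_frequently_eq (hd2.analyticOnNhd hU)
    hconv (z₀ := 1) (by simp [hUdef]) ?_ hα
  -- both sides agree on the positive reals, which accumulate at `1`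
  have ht : Tendsto (fun n : ℕ => ((1 + 1 / ((n : ℝ) + 1) : ℝ) : ℂ)) atTop (𝓝[≠] 1) := by
    refine tendsto_nhdsWithin_iff.2 ⟨?_, Eventually.of_forall fun n => ?_⟩
    · have h0 : Tendsto (fun n : ℕ => 1 + 1 / ((n : ℝ) + 1)) atTop (𝓝 (1 + 0)) :=
        tendsto_one_div_add_atTop_nhds_zero_nat.const_add 1
      rw [add_zero] at h0
      exact_mod_cast (continuous_ofReal.tendsto 1).comp h0
    · have : (0 : ℝ) < 1 / ((n : ℝ) + 1) := by positivity
      simp only [Set.mem_compl_iff, Set.mem_singleton_iff]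
      intro h
      have h' : (1 + 1 / ((n : ℝ) + 1) : ℝ) = 1 := by exact_mod_cast h
      linarith
  exact ht.frequently (Frequently.of_forall fun n => hreal _ (by positivity))

/-! ### Period integrals of unary theta functions -/

/-- The integral `∫_0^∞ G(t) / √(t - iz) dt`. For `G(t) = F(it)` it is the period integral of `F`
over the imaginary axis, up to the factor `i` of `dτ = i dt`. -/
noncomputable def halfPeriod (G : ℝ → ℂ) (z : ℂ) : ℂ :=
  ∫ t in Set.Ioi (0 : ℝ), G t / Complex.sqrt (t - I * z)

lemma mordellKernel_add_one (μ : ℝ) {b : ℝ} {X : ℂ}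
    (hX : 1 - exp (X + 2 * Real.pi * I * b) ≠ 0) :
    mordellKernel (μ + 1) b X = mordellKernel μ b X - exp (μ * (X + 2 * Real.pi * I * b)) := by
  rw [mordellKernel, mordellKernel, ofReal_add, ofReal_one, add_mul, one_mul, exp_add]
  field_simp
  ring

/-- The terms `n ≥ 0` form a geometric series with sum `φ (-2πx)`, the terms `n < 0` one with sum
`φ (2πx)`, where `φ` is the kernel. -/
lemma hasSum_sign_mul_exp {μ : ℝ} (h0 : 0 < μ) (h1 : μ < 1) (b : ℝ) {x : ℝ} (hx : 0 < x) :
    HasSum (fun n : ℤ => (((n + μ) / |n + μ| : ℝ) : ℂ) * exp (2 * Real.pi * I * (n + μ) * b) *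
      (Real.exp (-2 * Real.pi * x * |n + μ|) : ℝ))
      (mordellKernel μ b (-(2 * Real.pi * x)) + mordellKernel μ b (2 * Real.pi * x)) := by
  have hpi := Real.pi_pos
  refine HasSum.of_nat_of_neg_add_one ?_ ?_
  · set q : ℂ := -(2 * Real.pi * x) + 2 * Real.pi * I * b with hq
    have hq1 : ‖exp q‖ < 1 := by
      rw [norm_exp, Real.exp_lt_one_iff]
      have : q.re = -(2 * Real.pi * x) := by simp [hq]
      rw [this]; nlinarith [mul_pos hpi hx]
    have h := (hasSum_geometric_of_norm_lt_one hq1).mul_left (exp (μ * q))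
    rw [mordellKernel, ← hq, div_eq_mul_inv]
    refine h.congr_fun ?_
    intro n
    have hpos : (0 : ℝ) < n + μ := by positivity
    rw [← exp_nat_mul, ← exp_add]
    push_cast [abs_of_pos hpos, div_self hpos.ne']
    rw [one_mul, ← exp_add]
    congr 1
    rw [hq]; ring
  · set p : ℂ := 2 * Real.pi * x + 2 * Real.pi * I * b with hp
    have hpre : p.re = 2 * Real.pi * x := by simp [hp]
    have hq1 : ‖exp (-p)‖ < 1 := by
      rw [norm_exp, Real.exp_lt_one_iff, neg_re, hpre]; nlinarith [mul_pos hpi hx]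
    have h := (hasSum_geometric_of_norm_lt_one hq1).mul_left (-exp ((μ - 1) * p))
    have hne : 1 - exp (-p) ≠ 0 := fun h => by
      rw [← sub_eq_zero.1 h, norm_one] at hq1; exact lt_irrefl _ hq1
    have hval : mordellKernel μ b (2 * Real.pi * x) = -exp ((μ - 1) * p) * (1 - exp (-p))⁻¹ := by
      have e1 : exp p = (exp (-p))⁻¹ := by rw [← exp_neg, neg_neg]
      have e2 : exp ((μ - 1) * p) = exp (μ * p) * exp (-p) := by rw [← exp_add]; congr 1; ring
      have hne' : exp (-p) - 1 ≠ 0 := fun h => hne (by rw [← neg_sub, h, neg_zero])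
      rw [mordellKernel, ← hp, e1, e2]
      have := exp_ne_zero (-p)
      field_simp
      ring
    rw [hval]
    refine h.congr_fun ?_
    intro n
    have hneg : ((-((n : ℤ) + 1) : ℤ) : ℝ) + μ < 0 := by
      push_cast
      have : (0 : ℝ) ≤ n := n.cast_nonneg
      linarith
    rw [← exp_nat_mul, neg_mul (exp _), ← exp_add, abs_of_neg hneg, div_neg, div_self hneg.ne]
    push_cast
    rw [neg_one_mul, neg_mul (exp _), ← exp_add]
    congr 2
    rw [hp]; ring

lemma inv_mul_unaryTheta_inv (μ b : ℝ) {s : ℝ} (hs : 0 < s) :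
    ((1 / (s * √s) : ℝ) : ℂ) * unaryTheta μ b s⁻¹ =
      I * exp (2 * Real.pi * I * μ * b) * unaryTheta b (-μ) s := by
  rw [unaryTheta_functional_equation μ b (inv_pos.2 hs), inv_inv, Real.sqrt_inv]
  have h1 : (s : ℂ) ≠ 0 := by exact_mod_cast hs.ne'
  have h2 : ((√s : ℝ) : ℂ) ≠ 0 := by exact_mod_cast (Real.sqrt_pos.2 hs).ne'
  push_cast
  field_simp

/-- The Laplace transform of a theta function. After the modular transformation every term of the
theta series becomes an inverse Gaussian density, and the masses `exp (-2πx|n + μ|)` of these sum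
up to two values of the Mordell kernel. -/
lemma integral_unaryTheta_mul_exp {μ : ℝ} (h0 : 0 < μ) (h1 : μ < 1) (b : ℝ) {x : ℝ}
    (hx : 0 < x) :
    ∫ s in Set.Ioi (0 : ℝ), I * exp (2 * Real.pi * I * μ * b) * unaryTheta b (-μ) s *
        exp (-Real.pi * s * x ^ 2) =
      mordellKernel μ b (-(2 * Real.pi * x)) + mordellKernel μ b (2 * Real.pi * x) := by
  have hne : ∀ n : ℤ, (n : ℝ) + μ ≠ 0 := fun n h => by
    have h2 : -1 < (n : ℝ) := by linarith
    have h3 : (n : ℝ) < 0 := by linarith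
    have h2' : -1 < n := by exact_mod_cast h2
    have h3' : n < 0 := by exact_mod_cast h3
    omega
  have habs : ∀ n : ℤ, 0 < |(n : ℝ) + μ| := fun n => abs_pos.2 (hne n)
  set F : ℤ → ℝ → ℂ := fun n s => (((n + μ) / |n + μ| : ℝ) : ℂ) *
    exp (2 * Real.pi * I * (n + μ) * b) * (invGauss x |n + μ| s : ℝ) with hF
  have hcn : ∀ n : ℤ, ‖(((n + μ) / |n + μ| : ℝ) : ℂ) * exp (2 * Real.pi * I * (n + μ) * b)‖ =
      1 := by
    intro n
    rw [norm_mul, show (2 * Real.pi * I * (n + μ) * b : ℂ) =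
      ((2 * Real.pi * (n + μ) * b : ℝ) : ℂ) * I by push_cast; ring, norm_exp_ofReal_mul_I,
      norm_real, Real.norm_eq_abs, abs_div, abs_abs, div_self (habs n).ne', mul_one]
  have hsum := hasSum_sign_mul_exp h0 h1 b hx
  have hnn : ∀ n : ℤ, ∀ s ∈ Set.Ioi (0 : ℝ), 0 ≤ invGauss x |n + μ| s := fun n s hs => by
    have hs : 0 < s := hs
    unfold invGauss; positivity
  have hint : ∀ n, Integrable (F n) (volume.restrict (Set.Ioi 0)) := fun n =>
    ((integral_invGauss hx (habs n)).1.ofReal).const_mul _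
  have hnorm : ∀ n, ∫ s in Set.Ioi (0 : ℝ), ‖F n s‖ =
      ‖(((n + μ) / |n + μ| : ℝ) : ℂ) * exp (2 * Real.pi * I * (n + μ) * b) *
      (Real.exp (-2 * Real.pi * x * |n + μ|) : ℝ)‖ := by
    intro n
    rw [norm_mul, hcn, one_mul, norm_real, Real.norm_of_nonneg (Real.exp_pos _).le,
      ← (integral_invGauss hx (habs n)).2]
    refine setIntegral_congr_fun measurableSet_Ioi fun s hs => ?_
    simp only [hF]
    rw [norm_mul, hcn, one_mul, norm_real, Real.norm_of_nonneg (hnn n s hs)]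
  have hS := hasSum_integral_of_summable_integral_norm hint
    (by simp_rw [hnorm]; exact hsum.summable.norm)
  have hval : ∀ n, ∫ s in Set.Ioi (0 : ℝ), F n s =
      (((n + μ) / |n + μ| : ℝ) : ℂ) * exp (2 * Real.pi * I * (n + μ) * b) *
      (Real.exp (-2 * Real.pi * x * |n + μ|) : ℝ) := fun n => by
    simp only [hF]
    rw [integral_const_mul, integral_complex_ofReal, (integral_invGauss hx (habs n)).2]
  simp_rw [hval] at hS
  rw [← hS.unique hsum]
  refine setIntegral_congr_fun measurableSet_Ioi fun s hs => ?_
  have hs : 0 < s := hs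
  rw [← inv_mul_unaryTheta_inv μ b hs, unaryTheta, ← tsum_mul_left, ← tsum_mul_right]
  refine tsum_congr fun n => ?_
  have hs0 : (s : ℂ) ≠ 0 := by exact_mod_cast hs.ne'
  have hr0 : ((√s : ℝ) : ℂ) ≠ 0 := by exact_mod_cast (Real.sqrt_pos.2 hs).ne'
  have ha0 : ((|n + μ| : ℝ) : ℂ) ≠ 0 := by exact_mod_cast (habs n).ne'
  have hexp : exp (-Real.pi * (s⁻¹ : ℝ) * (n + μ) ^ 2) * exp (-Real.pi * s * x ^ 2) =
      ((Real.exp (-Real.pi * |n + μ| ^ 2 / s - Real.pi * x ^ 2 * s) : ℝ) : ℂ) := by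
    rw [← exp_add, sq_abs]
    push_cast
    congr 1
    field_simp
    ring
  simp only [hF, invGauss]
  rw [unaryThetaTerm, mul_assoc, mul_assoc ((n + μ : ℂ) * _), hexp]
  push_cast
  field_simp

lemma integrable_halfPeriod_integrand {G : ℝ → ℂ} (hG : IntegrableOn G (Set.Ioi 0)) {z : ℂ}
    (hz : 0 < z.im) :
    IntegrableOn (fun t : ℝ => G t / Complex.sqrt (t - I * z)) (Set.Ioi 0) := by
  have hre : ∀ t : ℝ, (t - I * z : ℂ).re = t + z.im := fun t => by simp
  have hc : ContinuousOn (fun t : ℝ => (Complex.sqrt (t - I * z))⁻¹) (Set.Ioi 0) := by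
    intro t ht
    have ht : 0 < t := ht
    have hslit : (t - I * z : ℂ) ∈ slitPlane := Or.inl (by rw [hre]; linarith)
    refine ContinuousAt.continuousWithinAt (ContinuousAt.inv₀ ?_ ?_)
    · exact ContinuousAt.comp (f := fun t : ℝ => (t - I * z : ℂ))
        (differentiableAt_sqrt hslit).continuousAt (by fun_prop)
    · exact Complex.sqrt_ne_zero (slitPlane_ne_zero hslit)
  simp_rw [div_eq_mul_inv]
  refine Integrable.mul_bdd (c := (√z.im)⁻¹) hG (hc.aestronglyMeasurable measurableSet_Ioi) ?_
  refine (ae_restrict_iff' measurableSet_Ioi).2 (Eventually.of_forall fun t ht => ?_)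
  have ht : 0 < t := ht
  rw [norm_inv, Complex.norm_sqrt]
  gcongr
  calc z.im ≤ (t - I * z : ℂ).re := by rw [hre]; linarith
    _ ≤ _ := (le_abs_self _).trans (abs_re_le_norm _)

/-- The integral identity of Zwegers: the period integral of a unary theta function is a Mordell
integral. Writing `1/√(s - iw)` as a Gaussian integral and exchanging the integrations leaves the
Laplace transform of the theta function. -/
lemma halfPeriod_unaryTheta {μ : ℝ} (h0 : 0 < μ) (h1 : μ < 1) {b : ℝ}
    (hb : ∀ n : ℤ, (n : ℝ) + b ≠ 0) {w : ℂ} (hw : 0 < w.im) :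
    I * exp (2 * Real.pi * I * μ * b) * halfPeriod (unaryTheta b (-μ)) w =
      2 * ∫ x, gaussKernel μ b (-Real.pi * I * w) (2 * Real.pi) x := by
  have hpi := Real.pi_pos
  have hne : ∀ n : ℤ, (n : ℝ) + -μ ≠ 0 := fun n h => by
    have h2 : 0 < (n : ℝ) := by linarith
    have h3 : (n : ℝ) < 1 := by linarith
    have h2' : 0 < n := by exact_mod_cast h2
    have h3' : n < 1 := by exact_mod_cast h3
    omega
  set D : ℝ → ℂ := fun s => I * exp (2 * Real.pi * I * μ * b) * unaryTheta b (-μ) s with hD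
  have hDi : IntegrableOn D (Set.Ioi 0) := (integrableOn_unaryTheta hb hne).const_mul _
  have hA : 0 < (-Real.pi * I * w : ℂ).re := by
    have : (-Real.pi * I * w : ℂ).re = Real.pi * w.im := by simp
    rw [this]; positivity
  have hγ : 0 < (2 * Real.pi : ℂ).re := by simpa using hpi
  have hgauss : Integrable fun x : ℝ => exp (Real.pi * I * w * x ^ 2) := by
    have := integrable_cexp_neg_mul_sq hA
    refine this.congr (Eventually.of_forall fun x => ?_)
    simp only; congr 1; ring
  -- `1/√(s - iw)` is a Gaussian integral
  have hL : I * exp (2 * Real.pi * I * μ * b) * halfPeriod (unaryTheta b (-μ)) w =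
      ∫ s in Set.Ioi (0 : ℝ), ∫ x : ℝ,
        D s * exp (-Real.pi * s * x ^ 2) * exp (Real.pi * I * w * x ^ 2) := by
    rw [halfPeriod, ← integral_const_mul]
    refine setIntegral_congr_fun measurableSet_Ioi fun s hs => ?_
    have hs : 0 < s := hs
    have hre : 0 < (s - I * w : ℂ).re := by simp; linarith
    simp_rw [mul_assoc (D s)]
    rw [integral_const_mul, div_eq_mul_inv, ← integral_exp_neg_pi_mul_sq hre, hD, ← mul_assoc]
    congr 2
    funext x
    rw [← exp_add]; congr 1; ring
  have hswap : Integrable (Function.uncurry fun (s x : ℝ) =>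
      D s * exp (-Real.pi * s * x ^ 2) * exp (Real.pi * I * w * x ^ 2))
      ((volume.restrict (Set.Ioi 0)).prod volume) := by
    have hp := Integrable.mul_prod hDi hgauss
    have hfun : (Function.uncurry fun (s x : ℝ) =>
        D s * exp (-Real.pi * s * x ^ 2) * exp (Real.pi * I * w * x ^ 2)) =
        fun p : ℝ × ℝ => (D p.1 * exp (Real.pi * I * w * p.2 ^ 2)) *
          exp (-Real.pi * p.1 * p.2 ^ 2) := by
      funext p; simp only [Function.uncurry]; ring
    rw [hfun]
    refine Integrable.mul_bdd (c := 1) hp (Continuous.aestronglyMeasurable (by fun_prop)) ?_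
    have hae : ∀ᵐ p : ℝ × ℝ ∂((volume.restrict (Set.Ioi 0)).prod volume), p.1 ∈ Set.Ioi (0 : ℝ) :=
      Measure.quasiMeasurePreserving_fst.ae (ae_restrict_mem measurableSet_Ioi)
    filter_upwards [hae] with p hp
    have hp : 0 < p.1 := hp
    rw [show (-Real.pi * p.1 * p.2 ^ 2 : ℂ) = ((-(Real.pi * p.1 * p.2 ^ 2) : ℝ) : ℂ) by
      push_cast; ring, norm_exp, ofReal_re]
    exact Real.exp_le_one_iff.2 (neg_nonpos.2 (by positivity))
  rw [hL, integral_integral_swap hswap]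
  have hi := integrable_gaussKernel μ hb hA hγ
  have hR : ∀ᵐ x : ℝ, (∫ s in Set.Ioi (0 : ℝ),
      D s * exp (-Real.pi * s * x ^ 2) * exp (Real.pi * I * w * x ^ 2)) =
      gaussKernel μ b (-Real.pi * I * w) (2 * Real.pi) x +
        gaussKernel μ b (-Real.pi * I * w) (2 * Real.pi) (-x) := by
    filter_upwards [compl_mem_ae_iff.2 (measure_singleton (0 : ℝ))] with x hx
    have hx : x ≠ 0 := hx
    rw [integral_mul_const, gaussKernel, gaussKernel, ofReal_neg, neg_sq,
      show (-(-Real.pi * I * w) * x ^ 2 : ℂ) = Real.pi * I * w * x ^ 2 by ring, ← mul_add, mul_comm]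
    congr 1
    rcases hx.lt_or_gt with h | h
    · have := integral_unaryTheta_mul_exp h0 h1 b (neg_pos.2 h)
      rw [ofReal_neg, neg_sq] at this
      simp only [hD]
      rw [this]
      congr 2
      ring
    · have := integral_unaryTheta_mul_exp h0 h1 b h
      simp only [hD]
      rw [this, add_comm]
      congr 2
      ring
  rw [integral_congr_ae hR, integral_add hi hi.comp_neg,
    integral_neg_eq_self (gaussKernel μ b _ _) volume]
  ring

/-! ### Theta functions with rational characteristics -/

/-- Summation over `ℤ` by residue classes. -/
lemma sum_range_tsum_mul_add {N : ℕ} (hN : N ≠ 0) {f : ℤ → ℂ} (hf : Summable f) :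
    ∑ l ∈ Finset.range N, ∑' m : ℤ, f (N * m + l) = ∑' k : ℤ, f k := by
  have : NeZero N := ⟨hN⟩
  have hs : Summable fun p : ℤ × Fin N => f ((Int.divModEquiv N).symm p) :=
    (Int.divModEquiv N).symm.summable_iff.2 hf
  have hs' : Summable fun p : Fin N × ℤ =>
      f ((Int.divModEquiv N).symm (Equiv.prodComm (Fin N) ℤ p)) :=
    (Equiv.prodComm (Fin N) ℤ).summable_iff.2 hs
  rw [← (Int.divModEquiv N).symm.tsum_eq f,
    ← (Equiv.prodComm (Fin N) ℤ).tsum_eq fun p => f ((Int.divModEquiv N).symm p)]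
  rw [Summable.tsum_prod' hs' fun l => hs'.prod_factor l, tsum_fintype, Finset.sum_range]
  refine Finset.sum_congr rfl fun l _ => tsum_congr fun m => ?_
  simp only [Equiv.prodComm_apply, Prod.swap_prod_mk, Int.divModEquiv, Equiv.coe_fn_symm_mk]
  congr 1
  ring

lemma exp_pi_mul_I_mul_nat (n : ℕ) : exp (Real.pi * I * n) = (-1) ^ n := by
  rw [mul_comm, exp_nat_mul, exp_pi_mul_I]

/-- The theta function `Θ₂(a, b, c; it) / (6c)` with `r = a / c` and `β = b / c`, as a combination
of two unary theta functions; see `Theta2_eq_directPair`. -/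
noncomputable def directPair (r β t : ℝ) : ℂ :=
  exp (-Real.pi * I * β) * exp (-2 * Real.pi * I * (1 / 2 - 3 * β) * (r + 1 / 6)) *
      unaryTheta (r + 1 / 6) (1 / 2 - 3 * β) (3 * t) +
    exp (Real.pi * I * β) * exp (-2 * Real.pi * I * (1 / 2 - 3 * β) * (r - 1 / 6)) *
      unaryTheta (r - 1 / 6) (1 / 2 - 3 * β) (3 * t)

/-- The theta function `Θ₁(a, b, c; it) / c` with `r = a / c` and `β = b / c`, as a combination of
the two unary theta functions dual to those of `directPair`; see `Theta1_eq_dualPair`. -/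
noncomputable def dualPair (r β t : ℝ) : ℂ :=
  exp (-Real.pi * I * β) * unaryTheta (1 / 2 - 3 * β) (-(r + 1 / 6)) (t / 3) +
    exp (Real.pi * I * β) * unaryTheta (1 / 2 - 3 * β) (-(r - 1 / 6)) (t / 3)

/-- Either half of `Θ₂` (`e = 1` and `e = -1`): the residue classes modulo `2c` are glued
together. -/
lemma sum_thetaTilde_eq (a b e : ℤ) {c : ℕ} (hc : c ≠ 0) {t : ℝ} (ht : 0 < t) :
    ∑ l ∈ Finset.range (2 * c), (-1) ^ l * exp (-Real.pi * I * b / c * (6 * l + e)) *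
        thetaTilde (6 * c * l + 6 * a + e * c) (12 * c ^ 2) (I * t) =
      6 * c * (exp (-Real.pi * I * (e * (b / c))) *
        exp (-2 * Real.pi * I * (1 / 2 - 3 * (b / c)) * (a / c + e / 6)) *
        unaryTheta (a / c + e / 6) (1 / 2 - 3 * (b / c)) (3 * t)) := by
  have hc0 : (c : ℂ) ≠ 0 := by exact_mod_cast hc
  have hs := summable_unaryThetaTerm (a / c + e / 6) (1 / 2 - 3 * (b / c)) (t := 3 * t)
    (by positivity)
  rw [← mul_assoc, unaryTheta, ← tsum_mul_left,
    ← sum_range_tsum_mul_add (N := 2 * c) (by simpa using hc) (hs.mul_left _)]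
  refine Finset.sum_congr rfl fun l _ => ?_
  rw [thetaTilde, ← tsum_mul_left]
  refine tsum_congr fun m => ?_
  have h1 : exp (-Real.pi * I * (e * (b / c))) *
        exp (-2 * Real.pi * I * (1 / 2 - 3 * (b / c)) * (a / c + e / 6)) *
        exp (2 * Real.pi * I * ((2 * c * m + l) + (a / c + e / 6)) * (1 / 2 - 3 * (b / c))) =
      (-1) ^ l * exp (-Real.pi * I * b / c * (6 * l + e)) := by
    rw [← exp_pi_mul_I_mul_nat, ← exp_add, ← exp_add, ← exp_add]
    refine exp_eq_exp_iff_exists_int.2 ⟨m * (c - 6 * b), ?_⟩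
    push_cast
    field_simp
    ring
  have h2 : exp (Real.pi * I * (I * t) / (12 * c ^ 2) *
        (12 * c ^ 2 * m + (6 * c * l + 6 * a + e * c)) ^ 2) =
      exp (-Real.pi * (3 * t) * ((2 * c * m + l) + (a / c + e / 6)) ^ 2) := by
    congr 1
    field_simp
    linear_combination (6 * (c * 12 * m + l * 6) * c + 36 * a + 6 * c * e) ^ 2 * t * I_sq
  have h3 : (12 * c ^ 2 * m + (6 * c * l + 6 * a + e * c) : ℂ) =
      6 * c * ((2 * c * m + l) + (a / c + e / 6)) := by
    field_simp; ring
  rw [unaryThetaTerm]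
  push_cast
  rw [h2, h3, ← h1]
  ring

lemma Theta2_eq_directPair (a b : ℤ) {c : ℕ} (hc : c ≠ 0) {t : ℝ} (ht : 0 < t) :
    Theta2 a b c (I * t) = 6 * c * directPair (a / c) (b / c) t := by
  have hp := sum_thetaTilde_eq a b 1 hc ht
  have hm := sum_thetaTilde_eq a b (-1) hc ht
  rw [Theta2, Finset.sum_add_distrib, directPair, mul_add]
  congr 1
  · rw [← mul_assoc] at hp ⊢
    convert hp using 1
    · refine Finset.sum_congr rfl fun l _ => ?_
      push_cast; ring_nf
    · push_cast; ring_nf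
  · convert hm using 1
    · refine Finset.sum_congr rfl fun l _ => ?_
      push_cast; ring_nf
    · push_cast; ring_nf

lemma two_cos_eq (k : ℤ) : (2 * cos (Real.pi * (2 * k + 1) / 6) : ℂ) =
    exp (Real.pi * I * (2 * k + 1) / 6) + exp (-(Real.pi * I * (2 * k + 1) / 6)) := by
  rw [cos]
  ring_nf

/-- The two summands of `dualPair`, combined termwise. The cosine is the sine of `Θ₁` up to sign and
vanishes for `k ≡ 1 mod 3`. -/
lemma dualPair_term (r β t : ℝ) (k : ℤ) :
    exp (-Real.pi * I * β) * unaryThetaTerm (1 / 2 - 3 * β) (-(r + 1 / 6)) (t / 3) k +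
        exp (Real.pi * I * β) * unaryThetaTerm (1 / 2 - 3 * β) (-(r - 1 / 6)) (t / 3) k =
      2 * cos (Real.pi * (2 * k + 1) / 6) * (k + 1 / 2 - 3 * β) *
        exp (-2 * Real.pi * I * r * (k + 1 / 2 - 3 * β)) *
          exp (-Real.pi * t / 3 * (k + 1 / 2 - 3 * β) ^ 2) := by
  have h1 : exp (-Real.pi * I * β) * exp (2 * Real.pi * I * (k + (1 / 2 - 3 * β)) *
        (-(r + 1 / 6))) =
      exp (-(Real.pi * I * (2 * k + 1) / 6)) *
        exp (-2 * Real.pi * I * r * (k + 1 / 2 - 3 * β)) := by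
    rw [← exp_add, ← exp_add]; congr 1; ring
  have h2 : exp (Real.pi * I * β) * exp (2 * Real.pi * I * (k + (1 / 2 - 3 * β)) * (-(r - 1 / 6))) =
      exp (Real.pi * I * (2 * k + 1) / 6) *
        exp (-2 * Real.pi * I * r * (k + 1 / 2 - 3 * β)) := by
    rw [← exp_add, ← exp_add]; congr 1; ring
  have h3 : exp (-Real.pi * (t / 3) * (k + (1 / 2 - 3 * β)) ^ 2) =
      exp (-Real.pi * t / 3 * (k + 1 / 2 - 3 * β) ^ 2) := by
    congr 1; ring
  rw [two_cos_eq, unaryThetaTerm, unaryThetaTerm]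
  push_cast
  rw [h3]
  linear_combination (k + 1 / 2 - 3 * β) * exp (-Real.pi * t / 3 * (k + 1 / 2 - 3 * β) ^ 2) *
    (h1 + h2)

lemma hasSum_dualPair (r β : ℝ) {t : ℝ} (ht : 0 < t) :
    HasSum (fun k : ℤ => 2 * cos (Real.pi * (2 * k + 1) / 6) * (k + 1 / 2 - 3 * β) *
        exp (-2 * Real.pi * I * r * (k + 1 / 2 - 3 * β)) *
          exp (-Real.pi * t / 3 * (k + 1 / 2 - 3 * β) ^ 2)) (dualPair r β t) := by
  have ht3 : 0 < t / 3 := by positivity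
  have h := ((summable_unaryThetaTerm (1 / 2 - 3 * β) (-(r + 1 / 6)) ht3).hasSum.mul_left
    (exp (-Real.pi * I * β))).add
      ((summable_unaryThetaTerm (1 / 2 - 3 * β) (-(r - 1 / 6)) ht3).hasSum.mul_left
        (exp (Real.pi * I * β)))
  exact h.congr_fun fun k => (dualPair_term r β t k).symm

lemma neg_one_pow_mul_sin (m : ℕ) : (-1) ^ m * sin (Real.pi / 3 * (2 * m + 1)) =
    cos (Real.pi * (2 * m + 1) / 6) := by
  have h : (Real.pi * (2 * m + 1) / 6 : ℂ) =
      Real.pi / 2 - (Real.pi / 3 * (2 * m + 1) - m * Real.pi) := by ring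
  rw [h, cos_pi_div_two_sub, sin_antiperiodic.sub_nat_mul_eq]

lemma Theta1_eq_dualPair (a b : ℤ) {c : ℕ} (hc : c ≠ 0) {t : ℝ} (ht : 0 < t) :
    Theta1 a b c (I * t) = c * dualPair (a / c) (b / c) t := by
  have hc0 : (c : ℂ) ≠ 0 := by exact_mod_cast hc
  have hs := hasSum_dualPair (a / c) (b / c) ht
  rw [← hs.tsum_eq, ← tsum_mul_left,
    ← sum_range_tsum_mul_add (N := 6 * c) (by simpa using hc) (hs.summable.mul_left _), Theta1,
    Finset.mul_sum]
  refine Finset.sum_congr rfl fun l _ => ?_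
  rw [thetaTilde, ← tsum_mul_left, ← tsum_mul_left]
  refine tsum_congr fun m => ?_
  have hcos : cos (Real.pi * (2 * ((6 * c : ℕ) * m + l : ℤ) + 1) / 6) =
      cos (Real.pi * (2 * l + 1) / 6) := by
    rw [← cos_add_int_mul_two_pi (Real.pi * (2 * l + 1) / 6) (c * m)]
    congr 1; push_cast; ring
  have h1 : zetaRoot (c ^ 2) ^ (3 * a * b) * zetaRoot (2 * c) ^ (-a) *
      exp (-2 * Real.pi * I * l * a / c) =
      exp (-2 * Real.pi * I * (a / c) * (6 * c * m + l + 1 / 2 - 3 * (b / c))) := by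
    rw [zetaRoot, zetaRoot, ← exp_int_mul, ← exp_int_mul, ← exp_add, ← exp_add]
    refine exp_eq_exp_iff_exists_int.2 ⟨6 * a * m, ?_⟩
    push_cast
    field_simp
    ring
  have h2 : exp (Real.pi * I * (I * t) / (12 * c ^ 2) *
        (12 * c ^ 2 * m + (2 * l * c - 6 * b + c)) ^ 2) =
      exp (-Real.pi * t / 3 * (6 * c * m + l + 1 / 2 - 3 * (b / c)) ^ 2) := by
    congr 1
    field_simp
    linear_combination 12 * (c * (c * 12 * m + 2 * l + 1) - 6 * b) ^ 2 * t * I_sq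
  have h3 : (12 * c ^ 2 * m + (2 * l * c - 6 * b + c) : ℂ) =
      2 * c * (6 * c * m + l + 1 / 2 - 3 * (b / c)) := by
    field_simp; ring
  rw [hcos, neg_one_pow_mul_sin]
  push_cast
  rw [h2, h3, ← h1]
  ring

lemma cos_add_int_mul_pi_eq (x : ℂ) (m : ℤ) :
    cos (x + m * Real.pi) = exp (Real.pi * I * m) * cos x := by
  rw [cos_add, sin_int_mul_pi, mul_zero, sub_zero,
    show (Real.pi * I * m : ℂ) = m * Real.pi * I by ring, exp_mul_I, sin_int_mul_pi, zero_mul,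
    add_zero, mul_comm]

lemma two_cos_pi_div_six : (2 * cos (Real.pi / 6) : ℂ) = (√3 : ℝ) := by
  have h : (cos (Real.pi / 6) : ℂ) = ((Real.cos (Real.pi / 6) : ℝ) : ℂ) := by push_cast; rfl
  rw [h, Real.cos_pi_div_six]; push_cast; ring

/-- The two families of theta functions coincide up to exchanging their parameters: of the residue
classes modulo `3` in the series of `dualPair`, one vanishes and the other two are the summands of
`directPair`. -/
lemma dualPair_eq_directPair (r β : ℝ) {t : ℝ} (ht : 0 < t) :
    dualPair r β t = 3 * (√3 : ℝ) * exp (6 * Real.pi * I * r * β) * directPair (-β) r t := by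
  have hs := hasSum_dualPair r β ht
  have ht3 : 0 < 3 * t := by positivity
  rw [← hs.tsum_eq, ← sum_range_tsum_mul_add three_ne_zero hs.summable, Finset.sum_range_succ,
    Finset.sum_range_succ, Finset.sum_range_one, directPair, mul_add, unaryTheta, unaryTheta,
    ← (Equiv.addRight (1 : ℤ)).tsum_eq (unaryThetaTerm (-β - 1 / 6) _ _)]
  simp only [← tsum_mul_left]
  have h1 : ∀ m : ℤ, cos (Real.pi * (2 * (((3 : ℕ) * m + (1 : ℕ) : ℤ) : ℂ) + 1) / 6) = 0 := by
    intro m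
    rw [show (Real.pi * (2 * (((3 : ℕ) * m + (1 : ℕ) : ℤ) : ℂ) + 1) / 6 : ℂ) =
      Real.pi / 2 + m * Real.pi by push_cast; ring, cos_add_int_mul_pi_eq, cos_pi_div_two, mul_zero]
  simp only [h1, mul_zero, zero_mul, tsum_zero, add_zero]
  congr 1
  · refine tsum_congr fun m => ?_
    have hc : (2 * cos (Real.pi * (2 * (((3 : ℕ) * m + (0 : ℕ) : ℤ) : ℂ) + 1) / 6) : ℂ) =
        (√3 : ℝ) * exp (Real.pi * I * m) := by
      rw [show (Real.pi * (2 * (((3 : ℕ) * m + (0 : ℕ) : ℤ) : ℂ) + 1) / 6 : ℂ) =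
        Real.pi / 6 + m * Real.pi by push_cast; ring, cos_add_int_mul_pi_eq, ← two_cos_pi_div_six]
      ring
    have he : exp (Real.pi * I * m) *
        exp (-2 * Real.pi * I * r * (3 * m + 1 / 2 - 3 * β)) =
        exp (6 * Real.pi * I * r * β) * (exp (-Real.pi * I * r) *
          exp (-2 * Real.pi * I * (1 / 2 - 3 * r) * (-β + 1 / 6))) *
          exp (2 * Real.pi * I * (m + (-β + 1 / 6)) * (1 / 2 - 3 * r)) := by
      rw [← exp_add, ← exp_add, ← exp_add, ← exp_add]; congr 1; ring
    have hq : exp (-Real.pi * t / 3 * (3 * m + 1 / 2 - 3 * β) ^ 2) =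
        exp (-Real.pi * (3 * t) * (m + (-β + 1 / 6)) ^ 2) := by
      congr 1; ring
    rw [hc, unaryThetaTerm]
    push_cast
    rw [add_zero, hq]
    linear_combination (√3 : ℝ) * (3 * m + 1 / 2 - 3 * β) *
      exp (-Real.pi * (3 * t) * (m + (-β + 1 / 6)) ^ 2) * he
  · refine tsum_congr fun m => ?_
    have hc : (2 * cos (Real.pi * (2 * (((3 : ℕ) * m + (2 : ℕ) : ℤ) : ℂ) + 1) / 6) : ℂ) =
        (√3 : ℝ) * exp (Real.pi * I * (m + 1)) := by
      rw [show (Real.pi * (2 * (((3 : ℕ) * m + (2 : ℕ) : ℤ) : ℂ) + 1) / 6 : ℂ) =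
        -(Real.pi / 6) + (m + 1 : ℤ) * Real.pi by push_cast; ring, cos_add_int_mul_pi_eq, cos_neg,
        ← two_cos_pi_div_six]
      push_cast
      ring
    have he : exp (Real.pi * I * (m + 1)) *
        exp (-2 * Real.pi * I * r * (3 * m + 2 + 1 / 2 - 3 * β)) =
        exp (6 * Real.pi * I * r * β) * (exp (Real.pi * I * r) *
          exp (-2 * Real.pi * I * (1 / 2 - 3 * r) * (-β - 1 / 6))) *
          exp (2 * Real.pi * I * (m + 1 + (-β - 1 / 6)) * (1 / 2 - 3 * r)) := by
      rw [← exp_add, ← exp_add, ← exp_add, ← exp_add]; congr 1; ring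
    have hq : exp (-Real.pi * t / 3 * (3 * m + 2 + 1 / 2 - 3 * β) ^ 2) =
        exp (-Real.pi * (3 * t) * (m + 1 + (-β - 1 / 6)) ^ 2) := by
      congr 1; ring
    rw [hc, unaryThetaTerm, Equiv.coe_addRight]
    push_cast
    rw [hq]
    linear_combination (√3 : ℝ) * (3 * m + 2 + 1 / 2 - 3 * β) *
      exp (-Real.pi * (3 * t) * (m + 1 + (-β - 1 / 6)) ^ 2) * he

/-- The sine splits into two exponentials, which give the two summands of `directPair 0 r`. -/
lemma ThetaRatio_eq_directPair (r : ℝ) {t : ℝ} (ht : 0 < t) :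
    ThetaRatio r (I * t) = 3 * I * directPair 0 r t := by
  have ht3 : 0 < 3 * t := by positivity
  have hp := (summable_unaryThetaTerm (0 + 1 / 6) (1 / 2 - 3 * r) ht3).hasSum.mul_left
    (exp (-Real.pi * I * r) * exp (-2 * Real.pi * I * (1 / 2 - 3 * r) * ((0 : ℝ) + 1 / 6)))
  have hneg : HasSum (unaryThetaTerm (0 - 1 / 6) (1 / 2 - 3 * r) (3 * t) ∘ Equiv.neg ℤ) _ :=
    (Equiv.hasSum_iff (Equiv.neg ℤ)).2
      (summable_unaryThetaTerm (0 - 1 / 6) (1 / 2 - 3 * r) ht3).hasSum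
  have hm := hneg.mul_left
    (exp (Real.pi * I * r) * exp (-2 * Real.pi * I * (1 / 2 - 3 * r) * ((0 : ℝ) - 1 / 6)))
  have h := (hp.add hm).mul_left (3 * I)
  rw [ThetaRatio, directPair, unaryTheta, unaryTheta, ← h.tsum_eq]
  refine tsum_congr fun n => ?_
  have hn : ((-1) ^ n : ℂ) = exp (Real.pi * I * n) := by
    rw [mul_comm, exp_int_mul, exp_pi_mul_I]
  have hn' : exp (-(Real.pi * I * n)) = exp (Real.pi * I * n) :=
    exp_eq_exp_iff_exists_int.2 ⟨-n, by push_cast; ring⟩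
  have h1 : exp (-Real.pi * I * r) * exp (-2 * Real.pi * I * (1 / 2 - 3 * r) * (0 + 1 / 6)) *
      exp (2 * Real.pi * I * (n + (0 + 1 / 6)) * (1 / 2 - 3 * r)) =
      exp (Real.pi * I * n) * exp (-(Real.pi * r * (6 * n + 1)) * I) := by
    rw [← exp_add, ← exp_add, ← exp_add]; congr 1; ring
  have h2 : exp (Real.pi * I * r) * exp (-2 * Real.pi * I * (1 / 2 - 3 * r) * (0 - 1 / 6)) *
      exp (2 * Real.pi * I * (-n + (0 - 1 / 6)) * (1 / 2 - 3 * r)) =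
      exp (Real.pi * I * n) * exp ((Real.pi * r * (6 * n + 1)) * I) := by
    rw [← hn', ← exp_add, ← exp_add, ← exp_add]; congr 1; ring
  have h3 : exp (3 * Real.pi * I * (I * t) * (n + 1 / 6) ^ 2) =
      exp (-Real.pi * (3 * t) * (n + (0 + 1 / 6)) ^ 2) := by
    congr 1; linear_combination 3 * Real.pi * t * (n + 1 / 6) ^ 2 * I_sq
  have h4 : exp (-Real.pi * (3 * t) * (-n + (0 - 1 / 6)) ^ 2) =
      exp (-Real.pi * (3 * t) * (n + (0 + 1 / 6)) ^ 2) := by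
    congr 1; ring
  rw [hn, sin, h3]
  simp only [Function.comp_apply, Equiv.neg_apply, unaryThetaTerm]
  push_cast
  rw [h4]
  linear_combination (-3 * I * (n + 1 / 6) * exp (-Real.pi * (3 * t) * (n + (0 + 1 / 6)) ^ 2)) *
    (h1 - h2)

/-! ### Transformations of period integrals -/

lemma re_ofReal_sub_I_mul (t : ℝ) (z : ℂ) : (t - I * z : ℂ).re = t + z.im := by simp

lemma re_neg_I_mul (z : ℂ) : (-I * z : ℂ).re = z.im := by simp

lemma neg_one_div_im_pos {z : ℂ} (hz : 0 < z.im) : 0 < (-1 / z).im := by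
  have hz0 : z ≠ 0 := by rintro rfl; simp at hz
  rw [neg_div, one_div, neg_im, inv_im, neg_div, neg_neg]
  exact div_pos hz (normSq_pos.2 hz0)

lemma halfPeriod_comp_mul_left (G : ℝ → ℂ) {l : ℝ} (hl : 0 < l) {z : ℂ} (hz : 0 < z.im) :
    halfPeriod (fun t => G (l * t)) z = ((√l : ℝ) : ℂ)⁻¹ * halfPeriod G (l * z) := by
  have hr : ((√l : ℝ) : ℂ) ≠ 0 := by exact_mod_cast (Real.sqrt_pos.2 hl).ne'
  have h := integral_comp_mul_left_Ioi (fun u : ℝ => G u / Complex.sqrt (u - I * (l * z))) 0 hl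
  rw [mul_zero] at h
  have hll : (√l : ℝ) * (√l : ℝ) = (l : ℂ) := by exact_mod_cast Real.mul_self_sqrt hl.le
  have hl0 : (l : ℂ) ≠ 0 := by exact_mod_cast hl.ne'
  have h2 : halfPeriod (fun t => G (l * t)) z = (√l : ℝ) *
      ∫ t in Set.Ioi (0 : ℝ), G (l * t) / Complex.sqrt ((l * t : ℝ) - I * (l * z)) := by
    rw [halfPeriod, ← integral_const_mul]
    refine setIntegral_congr_fun measurableSet_Ioi fun t ht => ?_
    have ht : 0 < t := ht
    have hre : 0 < (t - I * z : ℂ).re := by rw [re_ofReal_sub_I_mul]; linarith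
    have : ((l * t : ℝ) - I * (l * z) : ℂ) = l * (t - I * z) := by push_cast; ring
    rw [this, Complex.sqrt_mul (by simpa using hl) hre, Complex.sqrt_ofReal hl.le]
    field_simp
  rw [h2, h, halfPeriod, real_smul, ← mul_assoc]
  congr 1
  push_cast
  rw [← hll]
  field_simp

/-- The substitution `t ↦ 1/t`. -/
lemma halfPeriod_inv (G : ℝ → ℂ) {z : ℂ} (hz : 0 < z.im) :
    halfPeriod G z = (Complex.sqrt (-I * z))⁻¹ *
      halfPeriod (fun s => ((1 / (s * √s) : ℝ) : ℂ) * G s⁻¹) (-1 / z) := by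
  have hz0 : z ≠ 0 := by rintro rfl; simp at hz
  have hw := neg_one_div_im_pos hz
  have h := integral_comp_rpow_Ioi (fun t : ℝ => G t / Complex.sqrt (t - I * z))
    (p := -1) (by norm_num)
  rw [halfPeriod, ← h, halfPeriod, ← integral_const_mul]
  refine setIntegral_congr_fun measurableSet_Ioi fun s hs => ?_
  have hs : 0 < s := hs
  have hr : 0 < √s := Real.sqrt_pos.2 hs
  have hre : 0 < (s - I * (-1 / z) : ℂ).re := by rw [re_ofReal_sub_I_mul]; linarith
  have hre' : 0 < (-I * z : ℂ).re := by rwa [re_neg_I_mul]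
  have hreL : 0 < (((s⁻¹ : ℝ) : ℂ) - I * z).re := by
    rw [re_ofReal_sub_I_mul]; have := inv_pos.2 hs; linarith
  have hs0 : (s : ℂ) ≠ 0 := by exact_mod_cast hs.ne'
  have hr0 : ((√s : ℝ) : ℂ) ≠ 0 := by exact_mod_cast hr.ne'
  have hrr : ((√s : ℝ) : ℂ) * (√s : ℝ) = s := by exact_mod_cast Real.mul_self_sqrt hs.le
  have hsq : (√s : ℝ) * Complex.sqrt ((s⁻¹ : ℝ) - I * z) =
      Complex.sqrt (-I * z) * Complex.sqrt (s - I * (-1 / z)) := by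
    rw [← Complex.sqrt_mul hre' hre, ← Complex.sqrt_ofReal hs.le,
      ← Complex.sqrt_mul (by simpa using hs) hreL]
    congr 1
    push_cast
    field_simp
    linear_combination I_sq
  have hn1 : Complex.sqrt ((s⁻¹ : ℝ) - I * z) ≠ 0 :=
    Complex.sqrt_ne_zero fun h => by rw [h] at hreL; simp at hreL
  have hn2 : Complex.sqrt (-I * z) ≠ 0 :=
    Complex.sqrt_ne_zero fun h => by rw [h] at hre'; simp at hre'
  have hn3 : Complex.sqrt (s - I * (-1 / z)) ≠ 0 :=
    Complex.sqrt_ne_zero fun h => by rw [h] at hre; simp at hre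
  have hp : s ^ ((-1 : ℝ) - 1) = 1 / (s * s) := by
    rw [show (-1 : ℝ) - 1 = -(2 : ℕ) by norm_num, Real.rpow_neg hs.le, Real.rpow_natCast, sq,
      one_div]
  simp only [Real.rpow_neg_one]
  rw [hp, abs_neg, abs_one, one_mul, real_smul]
  have e1 : (1 : ℂ) / Complex.sqrt ((s⁻¹ : ℝ) - I * z) =
      (√s : ℝ) / (Complex.sqrt (-I * z) * Complex.sqrt (s - I * (-1 / z))) := by
    rw [← hsq]; field_simp
  rw [div_eq_mul_one_div (G s⁻¹), e1]
  push_cast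
  nth_rewrite 2 [← hrr]
  field_simp

lemma periodIntegrand_eq (F : ℂ → ℂ) (z : ℂ) (t : ℝ) :
    periodIntegrand F z t = F (I * t) / Complex.sqrt (t - I * z) := by
  rw [periodIntegrand]
  congr 2
  linear_combination (-t : ℂ) * I_sq

lemma periodIntegral_eq (F : ℂ → ℂ) (z : ℂ) :
    periodIntegral F z = I * halfPeriod (fun t => F (I * t)) z := by
  simp only [periodIntegral, halfPeriod, periodIntegrand_eq]

lemma halfPeriod_congr {F G : ℝ → ℂ} (h : ∀ t, 0 < t → F t = G t) (z : ℂ) :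
    halfPeriod F z = halfPeriod G z := by
  refine setIntegral_congr_fun measurableSet_Ioi fun t ht => ?_
  simp only [h t ht]

lemma halfPeriod_const_mul (k : ℂ) (G : ℝ → ℂ) (z : ℂ) :
    halfPeriod (fun t => k * G t) z = k * halfPeriod G z := by
  simp only [halfPeriod, mul_div_assoc, integral_const_mul]

lemma halfPeriod_add {F G : ℝ → ℂ} (hF : IntegrableOn F (Set.Ioi 0))
    (hG : IntegrableOn G (Set.Ioi 0)) {z : ℂ} (hz : 0 < z.im) :
    halfPeriod (fun t => F t + G t) z = halfPeriod F z + halfPeriod G z := by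
  simp only [halfPeriod, add_div]
  exact integral_add (integrable_halfPeriod_integrand hF hz)
    (integrable_halfPeriod_integrand hG hz)

/-! ### The Mordell integral of one kernel -/

lemma re_two_pi_I_div_pos {w : ℂ} (hw : 0 < w.im) : 0 < (2 * Real.pi * I / (3 * w) : ℂ).re := by
  have hw0 : w ≠ 0 := by rintro rfl; simp at hw
  have : (2 * Real.pi * I / (3 * w) : ℂ) = ((2 * Real.pi / 3 : ℝ) : ℂ) * (-I * w)⁻¹ := by
    push_cast
    field_simp
    rw [I_sq]
  rw [this, re_ofReal_mul, inv_re, re_neg_I_mul]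
  have : 0 < normSq (-I * w) := normSq_pos.2 (mul_ne_zero (neg_ne_zero.2 I_ne_zero) hw0)
  have := Real.pi_pos
  positivity

/-- The value of the Mordell integral of a single kernel for `0 < μ < 1`, as a period integral.
Unlike the Mordell integral it is `1`-periodic in `μ`. -/
noncomputable def thetaSide (μ b : ℝ) (w : ℂ) : ℂ :=
  Real.pi / 3 * I * (exp (2 * Real.pi * I * μ * b) * halfPeriod (unaryTheta b (-μ)) w)

lemma thetaSide_add_one (μ b : ℝ) (w : ℂ) : thetaSide (μ + 1) b w = thetaSide μ b w := by
  simp only [thetaSide, ← halfPeriod_const_mul]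
  congr 1
  funext t
  congr 1
  rw [unaryTheta, unaryTheta, ← tsum_mul_left, ← tsum_mul_left]
  refine tsum_congr fun n => ?_
  have : exp (2 * Real.pi * I * (μ + 1) * b) * exp (2 * Real.pi * I * (n + b) * (-(μ + 1))) =
      exp (2 * Real.pi * I * μ * b) * exp (2 * Real.pi * I * (n + b) * (-μ)) := by
    rw [← exp_add, ← exp_add]
    exact exp_eq_exp_iff_exists_int.2 ⟨-n, by push_cast; ring⟩
  rw [unaryThetaTerm, unaryThetaTerm]
  push_cast
  linear_combination (n + b) * exp (-Real.pi * t * (n + b) ^ 2) * this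

lemma mul_integral_gaussKernel_eq_thetaSide {μ : ℝ} (h0 : 0 < μ) (h1 : μ < 1) {b : ℝ}
    (hb : ∀ n : ℤ, (n : ℝ) + b ≠ 0) {w α : ℂ} (hw : 0 < w.im)
    (hα : α = 2 * Real.pi * I / (3 * w)) :
    α * ∫ x, gaussKernel μ b (3 / 2 * α) (3 * α) x = thetaSide μ b w := by
  have hw0 : w ≠ 0 := by rintro rfl; simp at hw
  have hpi : (Real.pi : ℂ) ≠ 0 := by exact_mod_cast Real.pi_ne_zero
  have hA : (2 * Real.pi ^ 2 / 3 * α⁻¹ : ℂ) = -Real.pi * I * w := by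
    rw [hα]
    field_simp
    rw [I_sq]; ring
  rw [integral_gaussKernel_rotate μ hb (hα ▸ re_two_pi_I_div_pos hw), hA, thetaSide]
  linear_combination -(Real.pi / 3 : ℂ) * halfPeriod_unaryTheta h0 h1 hb hw

/-- Raising `μ` by `1` changes the kernel by an exponential, hence the Mordell integral by a
Gaussian integral. This is the source of the correction terms. -/
lemma mul_integral_gaussKernel_add_one (μ : ℝ) {b : ℝ} (hb : ∀ n : ℤ, (n : ℝ) + b ≠ 0) {w α : ℂ}
    (hw : 0 < w.im) (hα : α = 2 * Real.pi * I / (3 * w)) :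
    α * ∫ x, gaussKernel (μ + 1) b (3 / 2 * α) (3 * α) x =
      α * (∫ x, gaussKernel μ b (3 / 2 * α) (3 * α) x) -
        2 * Real.pi / 3 * (exp (2 * Real.pi * I * μ * b) * exp (3 / 2 * α * μ ^ 2)) /
          Complex.sqrt (-I * w) := by
  have hw0 : w ≠ 0 := by rintro rfl; simp at hw
  have hpi : (Real.pi : ℂ) ≠ 0 := by exact_mod_cast Real.pi_ne_zero
  have hαre : 0 < α.re := hα ▸ re_two_pi_I_div_pos hw
  have hα0 : α ≠ 0 := by rintro rfl; simp at hαre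
  have h3 : 0 < (3 * α).re := by simpa using hαre
  have h32 : 0 < (3 / 2 * α).re := by
    have : (3 / 2 * α : ℂ) = ((3 / 2 : ℝ) : ℂ) * α := by push_cast; ring
    rw [this, re_ofReal_mul]; positivity
  have hneg : (-(3 / 2 * α)).re < 0 := by rw [neg_re]; linarith
  have hfun : gaussKernel (μ + 1) b (3 / 2 * α) (3 * α) = fun x =>
      gaussKernel μ b (3 / 2 * α) (3 * α) x -
        exp (-(3 / 2 * α) * x ^ 2 + 3 * α * μ * x + 2 * Real.pi * I * μ * b) := by
    funext x
    rw [gaussKernel, gaussKernel, mordellKernel_add_one μ (one_sub_exp_ne_zero hb h3 x), mul_sub,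
      ← exp_add]
    congr 2
    ring
  have hsq : Complex.sqrt (-I * w) ≠ 0 :=
    Complex.sqrt_ne_zero (mul_ne_zero (neg_ne_zero.2 I_ne_zero) hw0)
  have hss : Complex.sqrt (-I * w) * Complex.sqrt (-I * w) = -I * w := by
    rw [← sq, Complex.sqrt_sq]
  have hroot : (Real.pi / -(-(3 / 2 * α)) : ℂ) ^ (1 / 2 : ℂ) = Complex.sqrt (-I * w) := by
    rw [Complex.sqrt, one_div]
    congr 1
    rw [hα]
    field_simp
    rw [I_sq]; ring
  have hexp : exp (2 * Real.pi * I * μ * b - (3 * α * μ) ^ 2 / (4 * -(3 / 2 * α))) =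
      exp (2 * Real.pi * I * μ * b) * exp (3 / 2 * α * μ ^ 2) := by
    rw [← exp_add]
    congr 1
    field_simp
    ring
  rw [hfun, integral_sub (integrable_gaussKernel μ hb h32 h3)
    (integrable_cexp_quadratic' hneg _ _), integral_cexp_quadratic hneg, hroot, hexp, mul_sub]
  congr 1
  have hkey : α * (Complex.sqrt (-I * w) * Complex.sqrt (-I * w)) = 2 * Real.pi / 3 := by
    rw [hss, hα]
    field_simp
    rw [I_sq]; ring
  rw [← hkey]
  field_simp

/-- The correction term that appears when `r - 1/6` or `r + 1/6` leaves the interval `(0, 1)`;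
it equals both families `ε₁`, `ε₂` up to elementary factors. The value for `r = 1/6` or `r = 5/6`
is irrelevant. -/
noncomputable def corrTerm (r β : ℝ) (α w : ℂ) : ℂ :=
  if r < 1 / 6 then
    4 * Real.pi / 3 * (exp (Real.pi * I * β) * exp (3 / 2 * α * (r - 1 / 6) ^ 2)) /
      Complex.sqrt (-I * w)
  else if r < 5 / 6 then 0
  else 4 * Real.pi / 3 * (exp (5 * Real.pi * I * β) * exp (3 / 2 * α * (r - 5 / 6) ^ 2)) /
      Complex.sqrt (-I * w)

/-- The integrand of the Mordell integral `J(a, b, c; α)` with `r = a / c` and `β = b / c`, as a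
combination of two kernels; see `mordellIntegrandABC_eq`. -/
noncomputable def pairIntegrand (r β : ℝ) (α : ℂ) (x : ℝ) : ℂ :=
  2 * (exp (-Real.pi * I * β) * exp (-2 * Real.pi * I * (1 / 2 - 3 * β) * (r + 1 / 6)) *
      gaussKernel (r + 1 / 6) (1 / 2 - 3 * β) (3 / 2 * α) (3 * α) x +
    exp (Real.pi * I * β) * exp (-2 * Real.pi * I * (1 / 2 - 3 * β) * (r - 1 / 6)) *
      gaussKernel (r - 1 / 6) (1 / 2 - 3 * β) (3 / 2 * α) (3 * α) x)

lemma integrable_pairIntegrand (r : ℝ) {β : ℝ} (hb : ∀ n : ℤ, (n : ℝ) + (1 / 2 - 3 * β) ≠ 0)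
    {α : ℂ} (hα : 0 < α.re) : Integrable (pairIntegrand r β α) := by
  have h3 : 0 < (3 * α).re := by simpa using hα
  have h32 : 0 < (3 / 2 * α).re := by
    have : (3 / 2 * α : ℂ) = ((3 / 2 : ℝ) : ℂ) * α := by push_cast; ring
    rw [this, re_ofReal_mul]; positivity
  exact (((integrable_gaussKernel _ hb h32 h3).const_mul _).add
    ((integrable_gaussKernel _ hb h32 h3).const_mul _)).const_mul 2

/-- The common source of all four identities: the parameters `r ± 1/6` of the two kernels are moved
into `(0, 1)` by at most one shift, which contributes `corrTerm`. -/
lemma integral_pairIntegrand {r β : ℝ} (h0 : 0 ≤ r) (h1 : r < 1) (h16 : r ≠ 1 / 6)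
    (h56 : r ≠ 5 / 6) (hb : ∀ n : ℤ, (n : ℝ) + (1 / 2 - 3 * β) ≠ 0) {w α : ℂ} (hw : 0 < w.im)
    (hα : α = 2 * Real.pi * I / (3 * w)) :
    α * ∫ x, pairIntegrand r β α x = 2 * Real.pi / 3 * I *
      (exp (-Real.pi * I * β) * halfPeriod (unaryTheta (1 / 2 - 3 * β) (-(r + 1 / 6))) w +
        exp (Real.pi * I * β) * halfPeriod (unaryTheta (1 / 2 - 3 * β) (-(r - 1 / 6))) w) +
      corrTerm r β α w := by
  have hαre : 0 < α.re := hα ▸ re_two_pi_I_div_pos hw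
  have h3 : 0 < (3 * α).re := by simpa using hαre
  have h32 : 0 < (3 / 2 * α).re := by
    have : (3 / 2 * α : ℂ) = ((3 / 2 : ℝ) : ℂ) * α := by push_cast; ring
    rw [this, re_ofReal_mul]; positivity
  set b := 1 / 2 - 3 * β with hbdef
  have hcanc : ∀ μ : ℝ, exp (-2 * Real.pi * I * (1 / 2 - 3 * β) * μ) *
      exp (2 * Real.pi * I * μ * b) = 1 := fun μ => by
    rw [← exp_add, hbdef]
    exact exp_eq_one_iff.2 ⟨0, by push_cast; ring⟩
  have hp : exp (-2 * Real.pi * I * (1 / 2 - 3 * β) * (r + 1 / 6)) *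
      (α * ∫ x, gaussKernel (r + 1 / 6) b (3 / 2 * α) (3 * α) x) =
      Real.pi / 3 * I * halfPeriod (unaryTheta b (-(r + 1 / 6))) w +
      if r < 5 / 6 then 0 else
        2 * Real.pi / 3 * (exp (6 * Real.pi * I * β) * exp (3 / 2 * α * (r - 5 / 6) ^ 2)) /
          Complex.sqrt (-I * w) := by
    have hcp := hcanc (r + 1 / 6)
    push_cast at hcp
    split_ifs with h
    · rw [mul_integral_gaussKernel_eq_thetaSide (by linarith) (by linarith) hb hw hα, thetaSide]
      push_cast
      linear_combination (Real.pi / 3 * I * halfPeriod (unaryTheta b (-(r + 1 / 6))) w) * hcp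
    · have hr : 5 / 6 < r := lt_of_le_of_ne (not_lt.1 h) (Ne.symm h56)
      have hshift : r + 1 / 6 = (r - 5 / 6) + 1 := by ring
      have hm := mul_integral_gaussKernel_add_one (r - 5 / 6) hb hw hα
      rw [mul_integral_gaussKernel_eq_thetaSide (μ := r - 5 / 6) (by linarith) (by linarith)
          hb hw hα,
        ← thetaSide_add_one, ← hshift, thetaSide] at hm
      have he : exp (-2 * Real.pi * I * (1 / 2 - 3 * β) * (r + 1 / 6)) *
          exp (2 * Real.pi * I * (r - 5 / 6) * b) = -exp (6 * Real.pi * I * β) := by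
        have hneg : -exp (6 * Real.pi * I * β) = exp (6 * Real.pi * I * β + Real.pi * I) := by
          rw [exp_add, exp_pi_mul_I, mul_neg_one]
        rw [hneg, ← exp_add, hbdef]
        exact exp_eq_exp_iff_exists_int.2 ⟨-1, by push_cast; ring⟩
      rw [hm]
      push_cast
      linear_combination (Real.pi / 3 * I * halfPeriod (unaryTheta b (-(r + 1 / 6))) w) * hcp -
        2 * Real.pi / 3 * exp (3 / 2 * α * (r - 5 / 6) ^ 2) / Complex.sqrt (-I * w) * he
  have hmn : exp (-2 * Real.pi * I * (1 / 2 - 3 * β) * (r - 1 / 6)) *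
      (α * ∫ x, gaussKernel (r - 1 / 6) b (3 / 2 * α) (3 * α) x) =
      Real.pi / 3 * I * halfPeriod (unaryTheta b (-(r - 1 / 6))) w +
      if r < 1 / 6 then
        2 * Real.pi / 3 * exp (3 / 2 * α * (r - 1 / 6) ^ 2) / Complex.sqrt (-I * w) else 0 := by
    have hcm := hcanc (r - 1 / 6)
    push_cast at hcm
    split_ifs with h
    · have hm := mul_integral_gaussKernel_add_one (r - 1 / 6) hb hw hα
      rw [mul_integral_gaussKernel_eq_thetaSide (by linarith) (by linarith) hb hw hα,
        thetaSide_add_one,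
        thetaSide] at hm
      rw [← sub_eq_iff_eq_add.1 hm.symm |>.symm]
      push_cast
      linear_combination (Real.pi / 3 * I * halfPeriod (unaryTheta b (-(r - 1 / 6))) w +
        2 * Real.pi / 3 * exp (3 / 2 * α * (r - 1 / 6) ^ 2) / Complex.sqrt (-I * w)) * hcm
    · have hr : 1 / 6 < r := lt_of_le_of_ne (not_lt.1 h) (Ne.symm h16)
      rw [mul_integral_gaussKernel_eq_thetaSide (by linarith) (by linarith) hb hw hα, thetaSide]
      push_cast
      linear_combination (Real.pi / 3 * I * halfPeriod (unaryTheta b (-(r - 1 / 6))) w) * hcm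
  have hcorr : corrTerm r β α w = 2 * (exp (-Real.pi * I * β) * (if r < 5 / 6 then 0 else
        2 * Real.pi / 3 * (exp (6 * Real.pi * I * β) * exp (3 / 2 * α * (r - 5 / 6) ^ 2)) /
          Complex.sqrt (-I * w)) + exp (Real.pi * I * β) * (if r < 1 / 6 then
        2 * Real.pi / 3 * exp (3 / 2 * α * (r - 1 / 6) ^ 2) / Complex.sqrt (-I * w) else 0)) := by
    have he : exp (5 * Real.pi * I * β) = exp (-Real.pi * I * β) * exp (6 * Real.pi * I * β) := by
      rw [← exp_add]; congr 1; ring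
    rw [corrTerm]
    by_cases ha : r < 1 / 6
    · have hb' : r < 5 / 6 := by linarith
      simp only [ha, hb', if_true]; ring
    · by_cases hb' : r < 5 / 6
      · simp only [ha, hb', if_true, if_false]; ring
      · simp only [ha, hb', if_false]; rw [he]; ring
  simp only [pairIntegrand]
  rw [integral_const_mul, integral_add ((integrable_gaussKernel _ hb h32 h3).const_mul _)
    ((integrable_gaussKernel _ hb h32 h3).const_mul _), integral_const_mul, integral_const_mul,
    hcorr]
  linear_combination 2 * exp (-Real.pi * I * β) * hp + 2 * exp (Real.pi * I * β) * hmn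

lemma sqrt_three_mul_self : ((√3 : ℝ) : ℂ) * (√3 : ℝ) = 3 := by
  exact_mod_cast Real.mul_self_sqrt (by norm_num : (0 : ℝ) ≤ 3)

/-! ### Odd denominators -/


/-- A fraction with odd denominator is not an odd multiple of `1/6`. -/
lemma odd_int_div_ne {c : ℕ} (hc : Odd c) (m k : ℤ) : (m : ℝ) / c ≠ (2 * k + 1) / 6 := by
  obtain ⟨j, rfl⟩ := hc
  have h0 : ((2 * j + 1 : ℕ) : ℝ) ≠ 0 := by positivity
  intro h
  rw [div_eq_div_iff h0 (by norm_num)] at h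
  have h' : m * 6 = (2 * k + 1) * (2 * j + 1) := by exact_mod_cast h
  have h2 : m * 6 = 2 * (2 * k * j + k + j) + 1 := by rw [h']; ring
  omega

lemma int_add_half_sub_ne {c : ℕ} (hc : Odd c) (b n : ℤ) :
    (n : ℝ) + (1 / 2 - 3 * (b / c)) ≠ 0 := fun h =>
  odd_int_div_ne hc b n (by linarith)

lemma int_add_ne {c : ℕ} (hc : Odd c) (a n : ℤ) : (n : ℝ) + (a / c + 1 / 6) ≠ 0 := fun h =>
  odd_int_div_ne hc a (-3 * n - 1) (by push_cast; linarith)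

lemma int_sub_ne {c : ℕ} (hc : Odd c) (a n : ℤ) : (n : ℝ) + (a / c - 1 / 6) ≠ 0 := fun h =>
  odd_int_div_ne hc a (-3 * n) (by push_cast; linarith)

lemma int_add_neg_ne_zero {μ : ℝ} (h : ∀ n : ℤ, (n : ℝ) + μ ≠ 0) (n : ℤ) : (n : ℝ) + -μ ≠ 0 :=
  fun h' => h (-n) (by push_cast; linarith)

lemma mordellIntegrandABC_eq (a b : ℤ) {c : ℕ} (hc : Odd c) {α : ℂ} (hα : 0 < α.re) :
    mordellIntegrandABC a b c α = pairIntegrand (a / c) (b / c) α := by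
  funext x
  have h3 : 0 < (3 * α).re := by simpa using hα
  have hne := one_sub_exp_ne_zero (int_add_half_sub_ne hc b) h3 x
  set y : ℂ := 3 * α * x / 2 - 3 * Real.pi * I * (b / c) with hy
  have hE : exp (3 * α * x + 2 * Real.pi * I * (1 / 2 - 3 * (b / c) : ℝ)) = -(exp y * exp y) := by
    rw [← neg_one_mul, ← exp_pi_mul_I, ← exp_add, ← exp_add, hy]
    congr 1; push_cast; ring
  have hden : 1 - exp (3 * α * x + 2 * Real.pi * I * (1 / 2 - 3 * (b / c) : ℝ)) =
      2 * exp y * cosh y := by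
    have : exp y * exp (-y) = 1 := by rw [← exp_add, add_neg_cancel, exp_zero]
    rw [hE, cosh]; linear_combination -this
  have hcosh : cosh y ≠ 0 := fun h => hne (by rw [hden, h, mul_zero])
  have hy0 := exp_ne_zero y
  have z1 : zetaRoot c ^ b * exp (-α * x) * exp (3 * α * x * (a / c)) * exp y =
      exp (-Real.pi * I * (b / c)) * exp (-2 * Real.pi * I * (1 / 2 - 3 * (b / c)) *
        (a / c + 1 / 6)) * exp ((a / c + 1 / 6) * (3 * α * x + 2 * Real.pi * I *
          (1 / 2 - 3 * (b / c)))) := by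
    rw [zetaRoot, ← exp_int_mul, ← exp_add, ← exp_add, ← exp_add, ← exp_add, ← exp_add, hy]
    congr 1; ring
  have z2 : zetaRoot c ^ (2 * b) * exp (-2 * α * x) * exp (3 * α * x * (a / c)) * exp y =
      exp (Real.pi * I * (b / c)) * exp (-2 * Real.pi * I * (1 / 2 - 3 * (b / c)) *
        (a / c - 1 / 6)) * exp ((a / c - 1 / 6) * (3 * α * x + 2 * Real.pi * I *
          (1 / 2 - 3 * (b / c)))) := by
    rw [zetaRoot, ← exp_int_mul, ← exp_add, ← exp_add, ← exp_add, ← exp_add, ← exp_add, hy]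
    congr 1; push_cast; ring
  rw [mordellIntegrandABC, ← hy, pairIntegrand, gaussKernel, gaussKernel, mordellKernel,
    mordellKernel, hden, exp_add,
    show (-(3 / 2 * α) * x ^ 2 : ℂ) = -(3 / 2) * α * x ^ 2 by ring]
  push_cast
  have key : ∀ G P Z₁ Z₂ C₁ C₂ N₁ N₂ E C : ℂ, E ≠ 0 → C ≠ 0 → Z₁ * P * E = C₁ * N₁ →
      Z₂ * P * E = C₂ * N₂ → G * P * (Z₁ + Z₂) / C =
        2 * (C₁ * (G * (N₁ / (2 * E * C))) + C₂ * (G * (N₂ / (2 * E * C)))) := by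
    intro G P Z₁ Z₂ C₁ C₂ N₁ N₂ E C hE hC h₁ h₂
    field_simp
    linear_combination G * (h₁ + h₂)
  exact key _ _ _ _ _ _ _ _ _ _ hy0 hcosh z1 z2

lemma integrableOn_dualPair {r β : ℝ} (hb : ∀ n : ℤ, (n : ℝ) + (1 / 2 - 3 * β) ≠ 0)
    (hp : ∀ n : ℤ, (n : ℝ) + (r + 1 / 6) ≠ 0) (hm : ∀ n : ℤ, (n : ℝ) + (r - 1 / 6) ≠ 0)
    {z : ℂ} (hz : 0 < z.im) :
    IntegrableOn (dualPair r β) (Set.Ioi 0) ∧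
      halfPeriod (dualPair r β) z = (√3 : ℝ) *
        (exp (-Real.pi * I * β) * halfPeriod (unaryTheta (1 / 2 - 3 * β) (-(r + 1 / 6))) (z / 3) +
          exp (Real.pi * I * β) *
            halfPeriod (unaryTheta (1 / 2 - 3 * β) (-(r - 1 / 6))) (z / 3)) := by
  have hs : ∀ μ : ℝ, (∀ n : ℤ, (n : ℝ) + μ ≠ 0) →
      IntegrableOn (fun t => unaryTheta (1 / 2 - 3 * β) (-μ) (3⁻¹ * t)) (Set.Ioi 0) :=
      fun μ hμ => by
    have := (integrableOn_Ioi_comp_mul_left_iff (unaryTheta (1 / 2 - 3 * β) (-μ)) 0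
      (by norm_num : (0 : ℝ) < 3⁻¹)).2
    rw [mul_zero] at this
    exact this (integrableOn_unaryTheta hb (int_add_neg_ne_zero hμ))
  have hfun : dualPair r β = fun t =>
      exp (-Real.pi * I * β) * unaryTheta (1 / 2 - 3 * β) (-(r + 1 / 6)) (3⁻¹ * t) +
      exp (Real.pi * I * β) * unaryTheta (1 / 2 - 3 * β) (-(r - 1 / 6)) (3⁻¹ * t) := by
    funext t; rw [dualPair, div_eq_inv_mul t 3]
  rw [hfun]
  refine ⟨((hs _ hp).const_mul _).add ((hs _ hm).const_mul _), ?_⟩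
  have h3 : (((√3⁻¹ : ℝ) : ℂ))⁻¹ = (√3 : ℝ) := by rw [Real.sqrt_inv]; push_cast; rw [inv_inv]
  rw [halfPeriod_add ((hs _ hp).const_mul _) ((hs _ hm).const_mul _) hz, halfPeriod_const_mul,
    halfPeriod_const_mul, halfPeriod_comp_mul_left _ (by norm_num) hz,
    halfPeriod_comp_mul_left _ (by norm_num) hz, h3,
    show (((3⁻¹ : ℝ) : ℂ) * z) = z / 3 by push_cast; ring]
  ring

/-- The substitution `t ↦ 1/t` turns the period integral of `directPair` at `z` into that of the
dual theta functions at `-1/(3z)`. -/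
lemma integrableOn_directPair {r β : ℝ} (hb : ∀ n : ℤ, (n : ℝ) + (1 / 2 - 3 * β) ≠ 0)
    (hp : ∀ n : ℤ, (n : ℝ) + (r + 1 / 6) ≠ 0) (hm : ∀ n : ℤ, (n : ℝ) + (r - 1 / 6) ≠ 0)
    {z : ℂ} (hz : 0 < z.im) :
    IntegrableOn (directPair r β) (Set.Ioi 0) ∧
      halfPeriod (directPair r β) z = I / (3 * Complex.sqrt (-I * z)) *
        (exp (-Real.pi * I * β) *
            halfPeriod (unaryTheta (1 / 2 - 3 * β) (-(r + 1 / 6))) (-1 / (3 * z)) +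
          exp (Real.pi * I * β) *
            halfPeriod (unaryTheta (1 / 2 - 3 * β) (-(r - 1 / 6))) (-1 / (3 * z))) := by
  have hs : ∀ μ : ℝ, (∀ n : ℤ, (n : ℝ) + μ ≠ 0) →
      IntegrableOn (fun t => unaryTheta μ (1 / 2 - 3 * β) (3 * t)) (Set.Ioi 0) := fun μ hμ => by
    have := (integrableOn_Ioi_comp_mul_left_iff (unaryTheta μ (1 / 2 - 3 * β)) 0
      (by norm_num : (0 : ℝ) < 3)).2
    rw [mul_zero] at this
    exact this (integrableOn_unaryTheta hμ hb)
  have hz3 : 0 < (3 * z).im := by simpa using hz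
  have hre : 0 < (-I * z).re := by rwa [re_neg_I_mul]
  have hq0 : Complex.sqrt (-I * z) ≠ 0 :=
    Complex.sqrt_ne_zero fun h => by rw [h] at hre; simp at hre
  have hr0 : ((√3 : ℝ) : ℂ) ≠ 0 := by exact_mod_cast (Real.sqrt_pos.2 three_pos).ne'
  have hhalf : ∀ μ : ℝ, halfPeriod (fun t => unaryTheta μ (1 / 2 - 3 * β) (3 * t)) z =
      I / (3 * Complex.sqrt (-I * z)) * exp (2 * Real.pi * I * μ * (1 / 2 - 3 * β : ℝ)) *
        halfPeriod (unaryTheta (1 / 2 - 3 * β) (-μ)) (-1 / (3 * z)) := fun μ => by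
    have hsq : Complex.sqrt (-I * (3 * z)) = (√3 : ℝ) * Complex.sqrt (-I * z) := by
      rw [← Complex.sqrt_ofReal_mul three_pos hre]; congr 1; push_cast; ring
    rw [halfPeriod_comp_mul_left _ three_pos hz, ofReal_ofNat, halfPeriod_inv _ hz3,
      halfPeriod_congr (fun s hs => inv_mul_unaryTheta_inv μ (1 / 2 - 3 * β) hs),
      halfPeriod_const_mul, hsq]
    rw [← sqrt_three_mul_self]
    field_simp
  refine ⟨((hs _ hp).const_mul _).add ((hs _ hm).const_mul _), ?_⟩
  have hcanc : ∀ μ : ℝ, exp (-2 * Real.pi * I * (1 / 2 - 3 * β) * μ) *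
      exp (2 * Real.pi * I * μ * (1 / 2 - 3 * β : ℝ)) = 1 := fun μ => by
    rw [← exp_add]
    exact exp_eq_one_iff.2 ⟨0, by push_cast; ring⟩
  have hcp := hcanc (r + 1 / 6)
  have hcm := hcanc (r - 1 / 6)
  unfold directPair
  rw [halfPeriod_add ((hs _ hp).const_mul _) ((hs _ hm).const_mul _) hz, halfPeriod_const_mul,
    halfPeriod_const_mul, hhalf, hhalf]
  push_cast at hcp hcm ⊢
  linear_combination I / (3 * Complex.sqrt (-I * z)) * exp (-Real.pi * I * β) *
      halfPeriod (unaryTheta (1 / 2 - 3 * β) (-(r + 1 / 6))) (-1 / (3 * z)) * hcp +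
    I / (3 * Complex.sqrt (-I * z)) * exp (Real.pi * I * β) *
      halfPeriod (unaryTheta (1 / 2 - 3 * β) (-(r - 1 / 6))) (-1 / (3 * z)) * hcm

lemma integrableOn_periodIntegrand {F : ℂ → ℂ} {G : ℝ → ℂ} {k z : ℂ} (hz : 0 < z.im)
    (hFG : ∀ t : ℝ, 0 < t → F (I * t) = k * G t) (hG : IntegrableOn G (Set.Ioi 0)) :
    IntegrableOn (periodIntegrand F z) (Set.Ioi 0) ∧
      periodIntegral F z = I * (k * halfPeriod G z) := by
  refine ⟨?_, by rw [periodIntegral_eq, halfPeriod_congr hFG, halfPeriod_const_mul]⟩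
  refine (integrable_halfPeriod_integrand (hG.const_mul k) hz).congr_fun (fun t ht => ?_)
    measurableSet_Ioi
  rw [periodIntegrand_eq, hFG t ht]

/-! ### The Mordell integrals with two parameters -/

lemma re_two_pi_I_div_self_pos {z : ℂ} (hz : 0 < z.im) : 0 < (2 * Real.pi * I / z : ℂ).re := by
  have h := re_two_pi_I_div_pos (w := z / 3) (by
    rw [show z / 3 = ((1 / 3 : ℝ) : ℂ) * z by push_cast; ring, im_ofReal_mul]; positivity)
  rwa [mul_div_cancel₀ _ (by norm_num : (3 : ℂ) ≠ 0)] at h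

lemma re_neg_two_pi_I_mul_pos {z : ℂ} (hz : 0 < z.im) : 0 < (-2 * Real.pi * I * z : ℂ).re := by
  have : (-2 * Real.pi * I * z : ℂ) = ((2 * Real.pi : ℝ) : ℂ) * (-I * z) := by push_cast; ring
  rw [this, re_ofReal_mul, re_neg_I_mul]
  exact mul_pos Real.two_pi_pos hz

lemma zetaRoot_zpow_eq (c : ℕ) (k : ℤ) : zetaRoot c ^ k = exp (2 * Real.pi * I * (k / c)) := by
  rw [zetaRoot, ← exp_int_mul]; congr 1; ring

lemma eps1ABC_eq_corrTerm (a b : ℤ) {c : ℕ} (hc : c ≠ 0) {z : ℂ} (hz : 0 < z.im) :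
    eps1ABC a b c z =
      (√3 : ℝ) / (4 * Real.pi) * corrTerm (a / c) (b / c) (2 * Real.pi * I / z) (z / 3) := by
  have hz0 : z ≠ 0 := by rintro rfl; simp at hz
  have hc0 : (c : ℂ) ≠ 0 := by exact_mod_cast hc
  have hpi : (Real.pi : ℂ) ≠ 0 := by exact_mod_cast Real.pi_ne_zero
  have hre : 0 < (-I * z).re := by rwa [re_neg_I_mul]
  have hr0 : ((√3 : ℝ) : ℂ) ≠ 0 := by exact_mod_cast (Real.sqrt_pos.2 three_pos).ne'
  have hq0 : Complex.sqrt (-I * z) ≠ 0 :=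
    Complex.sqrt_ne_zero fun h => by rw [h] at hre; simp at hre
  have hsq : Complex.sqrt (-I * (z / 3)) = Complex.sqrt (-I * z) / (√3 : ℝ) := by
    rw [show -I * (z / 3) = ((3⁻¹ : ℝ) : ℂ) * (-I * z) by push_cast; ring,
      Complex.sqrt_ofReal_mul (by norm_num) hre, Real.sqrt_inv]
    push_cast; ring
  have key : ∀ A B A' B' q : ℂ, A = A' → B = B' → q ≠ 0 → A / q * B =
      (√3 : ℝ) / (4 * Real.pi) * (4 * Real.pi / 3 * (A' * B') / (q / (√3 : ℝ))) := by
    rintro A B _ _ q rfl rfl hq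
    field_simp
    linear_combination -A * B * sqrt_three_mul_self
  rw [eps1ABC, corrTerm, hsq]
  split_ifs
  · refine key _ _ _ _ _ ?_ ?_ hq0
    · rw [zetaRoot_zpow_eq]; congr 1; push_cast; field_simp
    · congr 1; push_cast; field_simp
  · rw [mul_zero]
  · refine key _ _ _ _ _ ?_ ?_ hq0
    · rw [zetaRoot_zpow_eq]; congr 1; push_cast; field_simp
    · congr 1; push_cast; field_simp

lemma eps2ABC_eq_corrTerm (a b : ℤ) {c : ℕ} (hc : c ≠ 0) {z : ℂ} (hz : 0 < z.im) :
    eps2ABC a b c z = zetaRoot (2 * c) ^ (-5 * b) * ((√3 : ℝ) / (2 * Real.pi)) /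
      Complex.sqrt (-I * z) *
        corrTerm (a / c) (b / c) (-2 * Real.pi * I * z) (-1 / (3 * z)) := by
  have hz0 : z ≠ 0 := by rintro rfl; simp at hz
  have hc0 : (c : ℂ) ≠ 0 := by exact_mod_cast hc
  have hpi : (Real.pi : ℂ) ≠ 0 := by exact_mod_cast Real.pi_ne_zero
  have hre : 0 < (-I * z).re := by rwa [re_neg_I_mul]
  have hr0 : ((√3 : ℝ) : ℂ) ≠ 0 := by exact_mod_cast (Real.sqrt_pos.2 three_pos).ne'
  have hq0 : Complex.sqrt (-I * z) ≠ 0 :=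
    Complex.sqrt_ne_zero fun h => by rw [h] at hre; simp at hre
  have hre3 : 0 < (((3 : ℝ) : ℂ) * (-I * z)).re := by rw [re_ofReal_mul]; positivity
  have hsq : Complex.sqrt (-I * (-1 / (3 * z))) = ((√3 : ℝ) * Complex.sqrt (-I * z))⁻¹ := by
    rw [← Complex.sqrt_ofReal_mul three_pos hre, ← Complex.sqrt_inv hre3]
    congr 1
    push_cast
    field_simp
    rw [I_sq]
  have key : ∀ A B A' B' q : ℂ, A = zetaRoot (2 * c) ^ (-5 * b) * A' → B = B' → q ≠ 0 →
      2 * A * B = zetaRoot (2 * c) ^ (-5 * b) * ((√3 : ℝ) / (2 * Real.pi)) / q *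
        (4 * Real.pi / 3 * (A' * B') / ((√3 : ℝ) * q)⁻¹) := by
    rintro A B A' _ q rfl rfl hq
    field_simp
    linear_combination -4 * zetaRoot (2 * c) ^ (-5 * b) * A' * B * sqrt_three_mul_self
  rw [eps2ABC, corrTerm, hsq]
  split_ifs
  · refine key _ _ _ _ _ ?_ ?_ hq0
    · rw [zetaRoot_zpow_eq, zetaRoot_zpow_eq, ← exp_add]; congr 1; push_cast; field_simp; ring
    · congr 1; push_cast; ring
  · rw [mul_zero]
  · refine (congrArg (· * _) (mul_one (2 : ℂ)).symm).trans (key 1 _ _ _ _ ?_ ?_ hq0)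
    · rw [zetaRoot_zpow_eq, ← exp_add, ← exp_zero]; congr 1; push_cast; field_simp; ring
    · congr 1; push_cast; ring

lemma div_mem_Ico {a : ℤ} {c : ℕ} (hc : Odd c) (ha0 : 0 ≤ a) (hac : a < c) :
    0 ≤ (a / c : ℝ) ∧ (a / c : ℝ) < 1 ∧ (a / c : ℝ) ≠ 1 / 6 ∧ (a / c : ℝ) ≠ 5 / 6 := by
  have hc0 : (0 : ℝ) < c := by exact_mod_cast hc.pos
  refine ⟨div_nonneg (by exact_mod_cast ha0) hc0.le,
    (div_lt_one hc0).2 (by exact_mod_cast hac), ?_, ?_⟩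
  · simpa using odd_int_div_ne hc a 0
  · have := odd_int_div_ne hc a 2
    norm_num at this ⊢
    exact this

/-- The identity for `J(a, b, c; 2πi/z)`: here `w = z/3`, where the theta functions are
`dualPair`. -/
lemma mordellJABC_inv {a b : ℤ} {c : ℕ} (hc : Odd c) (ha0 : 0 ≤ a) (hac : a < c) {z : ℂ}
    (hz : 0 < z.im) :
    Integrable (mordellIntegrandABC a b c (2 * Real.pi * I / z)) ∧
      IntegrableOn (periodIntegrand (Theta1 a b c) z) (Set.Ioi 0) ∧
      Real.sqrt 3 / (-2 * I * z) * mordellJABC a b c (2 * Real.pi * I / z) =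
        1 / (6 * c) * periodIntegral (Theta1 a b c) z + eps1ABC a b c z := by
  have hz0 : z ≠ 0 := by rintro rfl; simp at hz
  have hc0 : (c : ℂ) ≠ 0 := by exact_mod_cast hc.pos.ne'
  have hpi : (Real.pi : ℂ) ≠ 0 := by exact_mod_cast Real.pi_ne_zero
  have hα := re_two_pi_I_div_self_pos hz
  have hw : 0 < (z / 3).im := by
    rw [show z / 3 = ((1 / 3 : ℝ) : ℂ) * z by push_cast; ring, im_ofReal_mul]; positivity
  obtain ⟨h0, h1, h16, h56⟩ := div_mem_Ico hc ha0 hac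
  have hJ := integral_pairIntegrand h0 h1 h16 h56 (int_add_half_sub_ne hc b) hw
    (α := 2 * Real.pi * I / z) (by field_simp)
  obtain ⟨hDi, hD⟩ := integrableOn_dualPair (int_add_half_sub_ne hc b) (int_add_ne hc a)
    (int_sub_ne hc a) hz
  obtain ⟨hPi, hP⟩ := integrableOn_periodIntegrand hz
    (fun t ht => Theta1_eq_dualPair a b hc.pos.ne' ht) hDi
  refine ⟨?_, hPi, ?_⟩
  · rw [mordellIntegrandABC_eq a b hc hα]
    exact integrable_pairIntegrand _ (int_add_half_sub_ne hc b) hα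
  · rw [hP, hD, eps1ABC_eq_corrTerm a b hc.pos.ne' hz, mordellJABC,
      mordellIntegrandABC_eq a b hc hα]
    have hα0 : (2 * Real.pi * I / z : ℂ) ≠ 0 := fun h => by rw [h] at hα; simp at hα
    rw [eq_div_of_mul_eq hα0 ((mul_comm _ _).trans hJ)]
    have key : ∀ S K : ℂ, (√3 : ℝ) / (-2 * I * z) *
        ((2 * Real.pi / 3 * I * S + K) / (2 * Real.pi * I / z)) =
          1 / (6 * c) * (I * (c * ((√3 : ℝ) * S))) + (√3 : ℝ) / (4 * Real.pi) * K := by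
      intro S K
      field_simp [I_ne_zero]
      rw [I_sq]
      ring
    exact key _ _

/-- The identity for `J(a, b, c; -2πiz)`: here `w = -1/(3z)`, where the theta functions are
`directPair` after inversion. -/
lemma mordellJABC_mul {a b : ℤ} {c : ℕ} (hc : Odd c) (ha0 : 0 ≤ a) (hac : a < c) {z : ℂ}
    (hz : 0 < z.im) :
    Integrable (mordellIntegrandABC a b c (-2 * Real.pi * I * z)) ∧
      IntegrableOn (periodIntegrand (Theta2 a b c) z) (Set.Ioi 0) ∧
      zetaRoot (2 * c) ^ (-5 * b) * Real.sqrt 3 * Complex.sqrt (-I * z) *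
          mordellJABC a b c (-2 * Real.pi * I * z) =
        -(zetaRoot (2 * c) ^ (-5 * b)) * (I * Real.sqrt 3 / (6 * c)) *
          periodIntegral (Theta2 a b c) z + eps2ABC a b c z := by
  have hz0 : z ≠ 0 := by rintro rfl; simp at hz
  have hc0 : (c : ℂ) ≠ 0 := by exact_mod_cast hc.pos.ne'
  have hpi : (Real.pi : ℂ) ≠ 0 := by exact_mod_cast Real.pi_ne_zero
  have hα := re_neg_two_pi_I_mul_pos hz
  have hre : 0 < (-I * z).re := by rwa [re_neg_I_mul]
  have hq0 : Complex.sqrt (-I * z) ≠ 0 :=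
    Complex.sqrt_ne_zero fun h => by rw [h] at hre; simp at hre
  have hw : 0 < (-1 / (3 * z)).im := neg_one_div_im_pos (by simpa using hz)
  obtain ⟨h0, h1, h16, h56⟩ := div_mem_Ico hc ha0 hac
  have hJ := integral_pairIntegrand h0 h1 h16 h56 (int_add_half_sub_ne hc b) hw
    (α := -2 * Real.pi * I * z) (by field_simp)
  obtain ⟨hDi, hD⟩ := integrableOn_directPair (int_add_half_sub_ne hc b) (int_add_ne hc a)
    (int_sub_ne hc a) hz
  obtain ⟨hPi, hP⟩ := integrableOn_periodIntegrand hz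
    (fun t ht => Theta2_eq_directPair a b hc.pos.ne' ht) hDi
  refine ⟨?_, hPi, ?_⟩
  · rw [mordellIntegrandABC_eq a b hc hα]
    exact integrable_pairIntegrand _ (int_add_half_sub_ne hc b) hα
  · have hqq : Complex.sqrt (-I * z) * Complex.sqrt (-I * z) = -I * z := by
      rw [← sq, Complex.sqrt_sq]
    rw [hP, hD, eps2ABC_eq_corrTerm a b hc.pos.ne' hz, mordellJABC,
      mordellIntegrandABC_eq a b hc hα]
    have key : ∀ q J S K Z : ℂ, q ≠ 0 → q * q = -I * z →
        -2 * Real.pi * I * z * J = 2 * Real.pi / 3 * I * S + K →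
        Z * (√3 : ℝ) * q * J = -Z * (I * (√3 : ℝ) / (6 * c)) *
          (I * (6 * c * (I / (3 * q) * S))) + Z * ((√3 : ℝ) / (2 * Real.pi)) / q * K := by
      intro q J S K Z hq hqq hJ
      have hJ' : q * J = (2 * Real.pi / 3 * I * S + K) / (2 * Real.pi * q) := by
        rw [← hJ]
        field_simp
        linear_combination J * hqq
      rw [mul_assoc _ q, hJ']
      field_simp
      linear_combination (2 * Real.pi * I * S * Z) * I_sq
    exact key _ _ _ _ _ hq0 hqq hJ

/-! ### The case of vanishing second parameter -/

lemma mordellIntegrand_neg (r : ℝ) (α : ℂ) (x : ℝ) :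
    mordellIntegrand r α (-x) = mordellIntegrand r α x := by
  simp only [mordellIntegrand, ofReal_neg, mul_neg, neg_sq, cosh_neg, neg_div]

lemma mordellIntegrandABC_zero_add_neg (a : ℤ) (c : ℕ) (α : ℂ) (x : ℝ) :
    mordellIntegrandABC a 0 c α x + mordellIntegrandABC a 0 c α (-x) =
      2 * mordellIntegrand (a / c) α x := by
  simp only [mordellIntegrandABC, mordellIntegrand, mul_zero, zpow_zero, one_mul, Int.cast_zero,
    zero_div, sub_zero, ofReal_neg, mul_neg, neg_div, cosh_neg, neg_sq]
  have key : ∀ N₁ N₂ N D : ℂ, N₁ + N₂ = 2 * N → N₁ / D + N₂ / D = 2 * (N / D) := by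
    intro N₁ N₂ N D h
    rw [← add_div, h, mul_div_assoc]
  refine key _ _ _ _ ?_
  have h₁ := two_cosh ((3 * ((a / c : ℝ) : ℂ) - 1) * α * x)
  have h₂ := two_cosh ((3 * ((a / c : ℝ) : ℂ) - 2) * α * x)
  rw [mul_left_comm, mul_add (2 : ℂ), h₁, h₂]
  simp only [mul_add, ← exp_add]
  push_cast
  ring_nf

/-- Folding the integral over `ℝ` at `0` turns `J(a, 0, c; α)` into `2 J(a/c; α)`. -/
lemma mordellJABC_zero {a : ℤ} {c : ℕ} {α : ℂ} (h : Integrable (mordellIntegrandABC a 0 c α)) :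
    IntegrableOn (mordellIntegrand (a / c) α) (Set.Ioi 0) ∧
      mordellJABC a 0 c α = 2 * mordellJ (a / c) α := by
  have hfun : mordellIntegrand (a / c) α = fun x =>
      2⁻¹ * (mordellIntegrandABC a 0 c α x + mordellIntegrandABC a 0 c α (-x)) := by
    funext x
    rw [mordellIntegrandABC_zero_add_neg, inv_mul_cancel_left₀ two_ne_zero]
  have hint : Integrable (mordellIntegrand (a / c) α) := by
    rw [hfun]
    exact (h.add h.comp_neg).const_mul _
  refine ⟨hint.integrableOn, ?_⟩
  have hfold : ∫ x : ℝ, mordellIntegrand (a / c) α x = 2 * mordellJ (a / c) α := by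
    have hneg := integral_comp_neg_Ioi 0 (mordellIntegrand (a / c) α)
    simp only [mordellIntegrand_neg, neg_zero] at hneg
    rw [← integral_add_compl (measurableSet_Ioi (a := (0 : ℝ))) hint, Set.compl_Ioi, ← hneg,
      two_mul, mordellJ]
  rw [← hfold, hfun, integral_const_mul, integral_add h h.comp_neg,
    integral_neg_eq_self (mordellIntegrandABC a 0 c α) volume, mordellJABC]
  ring

lemma Theta1_zero_right_eq_ThetaRatio (a : ℤ) {c : ℕ} (hc : c ≠ 0) {t : ℝ} (ht : 0 < t) :
    Theta1 a 0 c (I * t) = -I * (√3 : ℝ) * c * ThetaRatio (a / c) (I * t) := by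
  rw [Theta1_eq_dualPair a 0 hc ht, ThetaRatio_eq_directPair _ ht, Int.cast_zero, zero_div,
    dualPair_eq_directPair _ _ ht]
  simp only [ofReal_zero, mul_zero, exp_zero, neg_zero]
  linear_combination 3 * c * (√3 : ℝ) * directPair 0 (a / c) t * I_sq

lemma Theta1_zero_left_eq_Theta2 (a : ℤ) {c : ℕ} (hc : c ≠ 0) {t : ℝ} (ht : 0 < t) :
    Theta1 0 (-a) c (I * t) = (√3 : ℝ) / 2 * Theta2 a 0 c (I * t) := by
  rw [Theta1_eq_dualPair 0 (-a) hc ht, Theta2_eq_directPair a 0 hc ht, Int.cast_zero, zero_div,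
    dualPair_eq_directPair _ _ ht, Int.cast_neg, neg_div, neg_neg]
  simp only [ofReal_zero, mul_zero, zero_mul, exp_zero]
  ring

lemma periodIntegral_of_axis_eq {F G : ℂ → ℂ} {k z : ℂ}
    (h : ∀ t : ℝ, 0 < t → F (I * t) = k * G (I * t))
    (hG : IntegrableOn (periodIntegrand G z) (Set.Ioi 0)) :
    IntegrableOn (periodIntegrand F z) (Set.Ioi 0) ∧
      periodIntegral F z = k * periodIntegral G z := by
  have he : ∀ t ∈ Set.Ioi (0 : ℝ), periodIntegrand F z t = k * periodIntegrand G z t :=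
    fun t ht => by rw [periodIntegrand, periodIntegrand, h t ht, mul_div_assoc]
  refine ⟨IntegrableOn.congr_fun (hG.const_mul k) (fun t ht => (he t ht).symm)
    measurableSet_Ioi, ?_⟩
  rw [periodIntegral, periodIntegral, setIntegral_congr_fun measurableSet_Ioi he,
    integral_const_mul]
  ring

lemma eps1_eq_eps1ABC (a : ℤ) (c : ℕ) (z : ℂ) : eps1 (a / c) z = -2 * eps1ABC a 0 c z := by
  rw [eps1, eps1ABC]
  split_ifs
  · push_cast; simp only [zpow_zero]; ring
  · rw [mul_zero]
  · push_cast; simp only [zpow_zero]; ring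

lemma eps2_eq_eps2ABC (a : ℤ) (c : ℕ) (z : ℂ) : eps2 (a / c) z = eps2ABC a 0 c z := by
  rw [eps2, eps2ABC]
  split_ifs
  · push_cast; simp only [zpow_zero]; ring
  · rfl
  · push_cast; rfl

/-- The case `b = 0` of `mordellJABC_inv`. -/
lemma mordellJ_inv {a : ℤ} {c : ℕ} (hc : Odd c) (ha0 : 0 ≤ a) (hac : a < c) {z : ℂ}
    (hz : 0 < z.im) :
    IntegrableOn (mordellIntegrand (a / c) (2 * Real.pi * I / z)) (Set.Ioi 0) ∧
      IntegrableOn (periodIntegrand (ThetaRatio (a / c)) z) (Set.Ioi 0) ∧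
      2 * Real.sqrt 3 / (I * z) * mordellJ (a / c) (2 * Real.pi * I / z) =
        I / Real.sqrt 3 * periodIntegral (ThetaRatio (a / c)) z + eps1 (a / c) z := by
  have hz0 : z ≠ 0 := by rintro rfl; simp at hz
  have hc0 : (c : ℂ) ≠ 0 := by exact_mod_cast hc.pos.ne'
  have hr0 : ((√3 : ℝ) : ℂ) ≠ 0 := by exact_mod_cast (Real.sqrt_pos.2 three_pos).ne'
  obtain ⟨hi, hp, hJ⟩ := mordellJABC_inv (b := 0) hc ha0 hac hz
  obtain ⟨hi', hJ'⟩ := mordellJABC_zero hi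
  obtain ⟨hp', hP⟩ := periodIntegral_of_axis_eq (F := ThetaRatio (a / c))
    (k := I / ((√3 : ℝ) * c)) (fun t ht => by
      rw [Theta1_zero_right_eq_ThetaRatio a hc.pos.ne' ht]
      field_simp
      rw [I_sq]
      ring) hp
  refine ⟨hi', hp', ?_⟩
  rw [eps1_eq_eps1ABC, hP]
  rw [hJ'] at hJ
  have key : ∀ J P E : ℂ, (√3 : ℝ) / (-2 * I * z) * (2 * J) = 1 / (6 * c) * P + E →
      2 * (√3 : ℝ) / (I * z) * J =
        I / (√3 : ℝ) * (I / ((√3 : ℝ) * c) * P) + -2 * E := by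
    intro J P E h
    have hs : I / ((√3 : ℝ) : ℂ) * (I / ((√3 : ℝ) * c) * P) = -P / (3 * c) := by
      rw [← sqrt_three_mul_self]
      field_simp
      linear_combination P * I_sq
    have hl : 2 * ((√3 : ℝ) : ℂ) / (I * z) * J = -2 * ((√3 : ℝ) / (-2 * I * z) * (2 * J)) := by
      field_simp [I_ne_zero]
    rw [hs, hl, h]
    field_simp
    ring
  exact key _ _ _ hJ

/-- The case `b = 0` of `mordellJABC_mul`. -/
lemma mordellJ_mul {a : ℤ} {c : ℕ} (hc : Odd c) (ha0 : 0 ≤ a) (hac : a < c) {z : ℂ}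
    (hz : 0 < z.im) :
    IntegrableOn (mordellIntegrand (a / c) (-2 * Real.pi * I * z)) (Set.Ioi 0) ∧
      IntegrableOn (periodIntegrand (Theta1 0 (-a) c) z) (Set.Ioi 0) ∧
      2 * Real.sqrt 3 * Complex.sqrt (-I * z) * mordellJ (a / c) (-2 * Real.pi * I * z) =
        -I / (3 * c) * periodIntegral (Theta1 0 (-a) c) z + eps2 (a / c) z := by
  obtain ⟨hi, hp, hJ⟩ := mordellJABC_mul (b := 0) hc ha0 hac hz
  obtain ⟨hi', hJ'⟩ := mordellJABC_zero hi
  obtain ⟨hp', hP⟩ := periodIntegral_of_axis_eq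
    (fun t ht => Theta1_zero_left_eq_Theta2 a hc.pos.ne' ht) hp
  refine ⟨hi', hp', ?_⟩
  rw [hJ', mul_zero, zpow_zero] at hJ
  rw [eps2_eq_eps2ABC, hP]
  linear_combination hJ

theorem theorem2p3 (c : ℕ) (hc : Odd c) (z : ℂ) (hz : 0 < z.im) :
    (∀ a : ℤ, 0 < a → a < c →
      (IntegrableOn (mordellIntegrand (a / c) (2 * Real.pi * I / z)) (Set.Ioi 0) ∧
        IntegrableOn (periodIntegrand (ThetaRatio (a / c)) z) (Set.Ioi 0) ∧
        2 * Real.sqrt 3 / (I * z) * mordellJ (a / c) (2 * Real.pi * I / z) =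
          I / Real.sqrt 3 * periodIntegral (ThetaRatio (a / c)) z + eps1 (a / c) z) ∧
      (IntegrableOn (mordellIntegrand (a / c) (-2 * Real.pi * I * z)) (Set.Ioi 0) ∧
        IntegrableOn (periodIntegrand (Theta1 0 (-a) c) z) (Set.Ioi 0) ∧
        2 * Real.sqrt 3 * Complex.sqrt (-I * z) * mordellJ (a / c) (-2 * Real.pi * I * z) =
          -I / (3 * c) * periodIntegral (Theta1 0 (-a) c) z + eps2 (a / c) z)) ∧
    (∀ a b : ℤ, 0 ≤ a → a < c → 0 < b → b < c →
      (Integrable (mordellIntegrandABC a b c (2 * Real.pi * I / z)) ∧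
        IntegrableOn (periodIntegrand (Theta1 a b c) z) (Set.Ioi 0) ∧
        Real.sqrt 3 / (-2 * I * z) * mordellJABC a b c (2 * Real.pi * I / z) =
          1 / (6 * c) * periodIntegral (Theta1 a b c) z + eps1ABC a b c z) ∧
      (Integrable (mordellIntegrandABC a b c (-2 * Real.pi * I * z)) ∧
        IntegrableOn (periodIntegrand (Theta2 a b c) z) (Set.Ioi 0) ∧
        zetaRoot (2 * c) ^ (-5 * b) * Real.sqrt 3 * Complex.sqrt (-I * z) *
            mordellJABC a b c (-2 * Real.pi * I * z) =
          -(zetaRoot (2 * c) ^ (-5 * b)) * (I * Real.sqrt 3 / (6 * c)) *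
            periodIntegral (Theta2 a b c) z + eps2ABC a b c z)) := by
  refine ⟨fun a ha0 hac => ⟨mordellJ_inv hc ha0.le hac hz, mordellJ_mul hc ha0.le hac hz⟩,
    fun a b ha0 hac _ _ => ⟨mordellJABC_inv hc ha0 hac hz, mordellJABC_mul hc ha0 hac hz⟩⟩
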